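/- **Setting.** Let $\Sigma\subset\mathbb R^{d+1}$ be a smooth ($C^\infty$), compact, connected, embedded hypersurface without boundary, with surface measure $d\Sigma$. Let $\mathcal P_\Sigma(p)$ be the orthogonal projection of $\mathbb R^{d+1}$ onto $\mathsf T_p\Sigma$. In local coordinates with tangent basis $\tau_i$ and dual basis $\tau^i$, and with $(a\otimes b)v=(b|v)\,a$, put, for vector fields $u,v:\Sigma\to\mathbb R^{d+1}$ (not necessarily tangential) and tensor fields $K$, $$\nabla_\Sigma u=\tau^i\otimes\partial_i u,\quad v\cdot\nabla_\Sigma u=(\nabla_\Sigma u)^{\sf T}v,\quad \operatorname{div}_\Sigma u=(\tau^i|\partial_i u),\quad \operatorname{div}_\Sigma K=(\partial_iK)^{\sf T}\tau^i,$$ $$\mathcal D_\Sigma(u)=\tfrac12\mathcal P_\Sigma\big(\nabla_\Sigma u+[\nabla_\Sigma u]^{\sf T}\big)\mathcal P_\Sigma,\qquad \mathcal T_\Sigma(u,\pi)=2\mu_s\mathcal D_\Sigma(u)-\pi\mathcal P_\Sigma,$$ where $\mu_s$ is a constant (the surface shear viscosity), and let $|\mathcal D_\Sigma(u)|^2=\mathcal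 D_\Sigma(u):\mathcal D_\Sigma(u)$ be the squared Hilbert–Schmidt norm. **Proposition 2.1.** Let $u_0:\Sigma\to\mathbb R^{d+1}$ be tangential, i.e. $u_0(p)\in\mathsf T_p\Sigma$ for all $p\in\Sigma$. Let $u(t,p)\in\mathbb R^{d+1}$ and $\pi(t,p)\in\mathbb R$ be a classical solution of the surface Navier–Stokes equations (with density one) $$\partial_t u+\mathcal P_\Sigma(u\cdot\nabla_\Sigma u)-\mathcal P_\Sigma\operatorname{div}_\Sigma\mathcal T_\Sigma(u,\pi)=0,\qquad \operatorname{div}_\Sigma u=0\quad\text{on }(0,T)\times\Sigma,\qquad u(0)=u_0\quad\text{on }\Sigma,$$ in the sense that $u$ is continuous on $[0,T)\times\Sigma$, $\partial_t u$ exists and is continuous on $(0,T)\times\Sigma$, and $u(t)\in C^2(\Sigma;\mathbb R^{d+1})$, $\pi(t)\in C^1(\Sigma)$ for each $t\in(0,T)$. (The field $u(t)$ is not assumed to be tangential for $t>0$.) Then, for every $t\in(0,T)$, the functions $|u(t)|^2$ and $|\mathcal D_\Sigma(u(t))|^2$ are integrable on $\Sigma$, the kinetic energy $\mathsf E(t)=\int_\Sigma\frac12|u(t)|^2\,d\Sigma$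 is differentiable at $t$, and $$\frac{d}{dt}\mathsf E(t)=-2\mu_s\int_\Sigma|\mathcal D_\Sigma(u(t))|^2\,d\Sigma .$$ -/

import Mathlib

open MeasureTheory Set
open scoped ContDiff

noncomputable section

namespace SurfaceFlow

/-- The ambient Euclidean space `ℝ^(d+1)`. -/
abbrev Ambient (d : ℕ) := EuclideanSpace ℝ (Fin (d + 1))

variable {d : ℕ}

/-- `S` is a smooth embedded `d`-dimensional hypersurface without boundary in `ℝ^(d+1)`: near each
of its points there is a smooth local diffeomorphism `Φ` of `ℝ^(d+1)` which straightens `S` to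
the hyperplane where the last coordinate vanishes. -/
def IsSmoothHypersurface (S : Set (Ambient d)) : Prop :=
  ∀ p ∈ S, ∃ Φ : OpenPartialHomeomorph (Ambient d) (Ambient d),
    p ∈ Φ.source ∧ ContDiffOn ℝ ∞ Φ Φ.source ∧ ContDiffOn ℝ ∞ Φ.symm Φ.target ∧
      ∀ x ∈ Φ.source, x ∈ S ↔ Φ x (Fin.last d) = 0

/-- The tangent space `T_p S`, as a linear subspace of the ambient space: the span of the
tangent directions of `S` at `p`. -/
def tangentSpaceAt (S : Set (Ambient d)) (p : Ambient d) : Submodule ℝ (Ambient d) :=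
  Submodule.span ℝ (tangentConeAt ℝ S p)

/-- The orthogonal projection `P_S(p)` of the ambient space onto the tangent space `T_p S`. -/
def proj (S : Set (Ambient d)) (p : Ambient d) : Ambient d →L[ℝ] Ambient d :=
  (tangentSpaceAt S p).starProjection

section Derivative

variable {F : Type*} [NormedAddCommGroup F] [NormedSpace ℝ F]

/-- The derivative along `S` of a function `f` given on `S`, as a linear map on the ambient space
which is zero on normal vectors: `v ↦ ∂_{P_S v} f`; in local coordinates `v ↦ (τ^i | v) ∂_i f`.
The full derivative of `f` within `S` is not unique in normal directions, but its restriction to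
the tangent space is, see `surfaceDeriv_eq`. -/
def surfaceDeriv (S : Set (Ambient d)) (f : Ambient d → F) (p : Ambient d) :
    Ambient d →L[ℝ] F :=
  (fderivWithin ℝ f S p).comp (proj S p)

/-- The derivative along `S` can be computed from any derivative of `f` within `S`, for instance
from the derivative of any differentiable extension of `f`. -/
theorem surfaceDeriv_eq {S : Set (Ambient d)} {f : Ambient d → F} {p : Ambient d}
    {f' : Ambient d →L[ℝ] F} (h : HasFDerivWithinAt f f' S p) :
    surfaceDeriv S f p = f'.comp (proj S p) := by
  have hon : Set.EqOn (fderivWithin ℝ f S p) f' (tangentConeAt ℝ S p) :=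
    h.differentiableWithinAt.hasFDerivWithinAt.unique_on h
  have hspan : Set.EqOn (fderivWithin ℝ f S p).toLinearMap f'.toLinearMap
      (Submodule.span ℝ (tangentConeAt ℝ S p)) := LinearMap.eqOn_span hon
  ext v
  exact hspan (Submodule.starProjection_apply_mem (tangentSpaceAt S p) v)

end Derivative

/-- The surface gradient `∇_S u = τ^i ⊗ ∂_i u` of a (not necessarily tangential) vector field,
where `(a ⊗ b) v = (b | v) a`; thus `(∇_S u) v = (∂_i u | v) τ^i`, and the transpose of `∇_S u` is
the derivative of `u` along `S`. -/
def surfaceGrad (S : Set (Ambient d)) (u : Ambient d → Ambient d) (p : Ambient d) :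
    Ambient d →L[ℝ] Ambient d :=
  ContinuousLinearMap.adjoint (surfaceDeriv S u p)

/-- `v · ∇_S u = (∇_S u)ᵀ v = v^i ∂_i u`. -/
def advect (S : Set (Ambient d)) (v u : Ambient d → Ambient d) (p : Ambient d) : Ambient d :=
  ContinuousLinearMap.adjoint (surfaceGrad S u p) (v p)

/-- The surface divergence `div_S u = (τ^i | ∂_i u)` of a (not necessarily tangential) vector field,
that is, the trace of `v ↦ (τ^i | v) ∂_i u`. -/
def surfaceDiv (S : Set (Ambient d)) (u : Ambient d → Ambient d) (p : Ambient d) : ℝ :=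
  LinearMap.trace ℝ (Ambient d) (surfaceDeriv S u p).toLinearMap

/-- The surface divergence `div_S K = (∂_i K)ᵀ τ^i` of a tensor field, written with the standard
basis `e_k` of the ambient space: since `P_S e_k = (τ^i | e_k) τ_i`, one has
`(∂_i K)ᵀ τ^i = ∑ k, (∂_{P_S e_k} K)ᵀ e_k`. -/
def surfaceDivTensor (S : Set (Ambient d)) (K : Ambient d → Ambient d →L[ℝ] Ambient d)
    (p : Ambient d) : Ambient d :=
  ∑ k : Fin (d + 1), ContinuousLinearMap.adjoint
    (surfaceDeriv S K p (EuclideanSpace.single k (1 : ℝ))) (EuclideanSpace.single k (1 : ℝ))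

/-- The surface rate-of-strain tensor `D_S(u) = ½ P_S (∇_S u + (∇_S u)ᵀ) P_S`. -/
def rateOfStrain (S : Set (Ambient d)) (u : Ambient d → Ambient d) (p : Ambient d) :
    Ambient d →L[ℝ] Ambient d :=
  (1 / 2 : ℝ) •
    (proj S p ∘L (surfaceGrad S u p + ContinuousLinearMap.adjoint (surfaceGrad S u p)) ∘L proj S p)

/-- The surface stress tensor `T_S(u, π) = 2 μ_s D_S(u) - π P_S` of an incompressible fluid. -/
def stress (S : Set (Ambient d)) (μs : ℝ) (u : Ambient d → Ambient d) (π : Ambient d → ℝ)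
    (p : Ambient d) : Ambient d →L[ℝ] Ambient d :=
  (2 * μs) • rateOfStrain S u p - π p • proj S p

/-- The squared Euclidean (Hilbert-Schmidt) norm `|A|² = A : A = ∑ k, |A e_k|²`. -/
def normSqHS (A : Ambient d →L[ℝ] Ambient d) : ℝ :=
  ∑ k : Fin (d + 1), ‖A (EuclideanSpace.single k (1 : ℝ))‖ ^ 2

/-- The surface measure of `S`: the `d`-dimensional Hausdorff measure, normalized so as to agree
with Lebesgue measure on `d`-dimensional Euclidean spaces, restricted to `S`. -/
def surfaceMeasure (S : Set (Ambient d)) : Measure (Ambient d) :=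
  (μHE[d] : Measure (Ambient d)).restrict S

/-- The kinetic energy `E = ∫_S ½ |u|² dS` of a velocity field. -/
def kineticEnergy (S : Set (Ambient d)) (u : Ambient d → Ambient d) : ℝ :=
  ∫ p, (1 / 2 : ℝ) * ‖u p‖ ^ 2 ∂(surfaceMeasure S)

/-- `(u, π)` is a classical solution on `(0, T)` of the surface Navier-Stokes equations on `S` with
density one, shear viscosity `μs` and initial value `u₀`. The velocity `u t p` takes values in the
ambient space and is not assumed to be tangential. Only the values at points of `S` and times in
`[0, T)` matter. For a subset `S` which is a smooth hypersurface, `ContDiffOn ℝ n f S` says that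
`f` is of class `C^n` in local coordinates of `S`. -/
structure IsClassicalSolution (S : Set (Ambient d)) (μs T : ℝ) (u₀ : Ambient d → Ambient d)
    (u : ℝ → Ambient d → Ambient d) (π : ℝ → Ambient d → ℝ) : Prop where
  continuousOn : ContinuousOn (fun z : ℝ × Ambient d => u z.1 z.2) (Ico 0 T ×ˢ S)
  contDiffOn_space : ∀ t ∈ Ioo 0 T, ContDiffOn ℝ 2 (u t) S
  differentiableAt_time : ∀ t ∈ Ioo 0 T, ∀ p ∈ S, DifferentiableAt ℝ (fun s => u s p) t
  continuousOn_deriv_time :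
    ContinuousOn (fun z : ℝ × Ambient d => deriv (fun s => u s z.2) z.1) (Ioo 0 T ×ˢ S)
  contDiffOn_pressure : ∀ t ∈ Ioo 0 T, ContDiffOn ℝ 1 (π t) S
  momentum : ∀ t ∈ Ioo 0 T, ∀ p ∈ S,
    deriv (fun s => u s p) t + proj S p (advect S (u t) (u t) p)
      - proj S p (surfaceDivTensor S (stress S μs (u t) (π t)) p) = 0
  incompressible : ∀ t ∈ Ioo 0 T, ∀ p ∈ S, surfaceDiv S (u t) p = 0
  initial : ∀ p ∈ S, u 0 p = u₀ p

end SurfaceFlow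

end

/-!
The momentum equation gives the time derivative of the velocity as a tangential vector, so the
normal component of the velocity is constant in time, and the velocity stays tangential
(`IsClassicalSolution.mem_tangentSpaceAt`). Hence the projections disappear when the momentum
equation is paired with the velocity, and since `div_S u = 0` the product rules for `div_S` yield
`(u | ∂_t u) = div_S (T_S u) - div_S (½ |u|² u) - 2 μ_s |D_S(u)|²`
(`IsClassicalSolution.inner_deriv_eq`); here the pressure drops out, and
`D_S(u) : ∇_S u = |D_S(u)|²` because `D_S(u)` is symmetric and tangential. Both fields under a
divergence are tangential and of class `C¹`, so their divergences have integral zero on the closed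
hypersurface. As `∂_t u` is bounded on compact time intervals, the energy can be differentiated
under the integral sign, and the energy balance follows.

The main work is the divergence theorem `integral_surfaceDiv_eq_zero` for surface measure, which is
a Hausdorff measure. It rests on two facts about a local parametrization `ψ` of `S` with derivative
`L`. The first is the area formula `LocalParam.map_restrict`: in local coordinates surface measure
has the density `g = √det (LᵀL)`. By the differentiation theorem for measures it is enough to
compute the measure of the images of small balls, on which `ψ` is comparable to its linear part up
to factors close to one. The second is `LocalParam.volumeFactor_mul_surfaceDiv`: for a tangential
field `v = L w` one has `g div_S v = div (g w)`. This comes from Jacobi's formula for the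
derivative of the determinant and from the symmetry of the second derivative of `ψ`. The integral of
the divergence of a compactly supported `C¹` field on `ℝ^d` vanishes, and a partition of unity
reduces the general case to fields which are supported in a coordinate patch.
-/

noncomputable section

namespace SurfaceFlow

open Filter Topology Metric

/-- The parameter space `ℝ^d`. -/
abbrev Param (d : ℕ) := EuclideanSpace ℝ (Fin d)

variable {d : ℕ}

/-! ### Hausdorff measure under maps which are comparable up to a factor -/

/-- The map `g` need not be injective on `s`: the assumption makes `f` a function of `g`, which is
Lipschitz with constant `c`. -/
theorem euclideanHausdorffMeasure_image_le_of_dist_le {A X Y : Type*} [MetricSpace X]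
    [MeasurableSpace X] [BorelSpace X] [MetricSpace Y] [MeasurableSpace Y] [BorelSpace Y]
    {f : A → X} {g : A → Y} {s : Set A} {c : NNReal}
    (h : ∀ y ∈ s, ∀ z ∈ s, dist (f y) (f z) ≤ c * dist (g y) (g z)) (n : ℕ) :
    (μHE[n] : Measure X) (f '' s) ≤ (c : ENNReal) ^ n * (μHE[n] : Measure Y) (g '' s) := by
  rcases s.eq_empty_or_nonempty with rfl | hne
  · simp
  have : Nonempty A := ⟨hne.some⟩
  have key : LipschitzOnWith c (f ∘ Function.invFunOn g s) (g '' s) := by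
    refine LipschitzOnWith.of_dist_le_mul fun p hp q hq => ?_
    have := h _ (Function.invFunOn_mem hp) _ (Function.invFunOn_mem hq)
    rwa [Function.invFunOn_eq hp, Function.invFunOn_eq hq] at this
  have hsub : f '' s ⊆ (f ∘ Function.invFunOn g s) '' (g '' s) := by
    rintro _ ⟨y, hy, rfl⟩
    have hy' : g y ∈ g '' s := mem_image_of_mem g hy
    refine ⟨g y, hy', ?_⟩
    have := h _ (Function.invFunOn_mem hy') y hy
    rw [Function.invFunOn_eq hy', dist_self, mul_zero] at this
    exact dist_le_zero.1 this
  have h1 := key.hausdorffMeasure_image_le (d := n) (Nat.cast_nonneg n)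
  rw [ENNReal.rpow_natCast] at h1
  rw [Measure.euclideanHausdorffMeasure_def, Measure.euclideanHausdorffMeasure_def,
    Measure.smul_apply, Measure.smul_apply, ENNReal.smul_def, ENNReal.smul_def, smul_eq_mul,
    smul_eq_mul, mul_left_comm]
  gcongr
  exact (measure_mono hsub).trans h1

/-- The factor by which an injective linear map scales `d`-dimensional volume: the square root of
the Gram determinant. -/
def volumeFactor {E F : Type*} [NormedAddCommGroup E] [InnerProductSpace ℝ E]
    [FiniteDimensional ℝ E] [NormedAddCommGroup F] [InnerProductSpace ℝ F] [FiniteDimensional ℝ F]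
    (L : E →L[ℝ] F) : ℝ :=
  √(ContinuousLinearMap.adjoint L ∘L L).det

/-- Polar-type decomposition `L = j M` with a linear isometry `j` and an endomorphism `M` of the
source; it makes the Gram determinant of `L` a square. -/
theorem exists_linearIsometry_comp {E F : Type*} [NormedAddCommGroup E] [InnerProductSpace ℝ E]
    [FiniteDimensional ℝ E] [NormedAddCommGroup F] [InnerProductSpace ℝ F] [FiniteDimensional ℝ F]
    {L : E →L[ℝ] F} (hL : Function.Injective L) :
    ∃ (j : E →ₗᵢ[ℝ] F) (M : E →ₗ[ℝ] E), (∀ x, j (M x) = L x) ∧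
      (ContinuousLinearMap.adjoint L ∘L L).det = LinearMap.det M ^ 2 := by
  have hfin : Module.finrank ℝ (LinearMap.range L.toLinearMap) = Module.finrank ℝ E :=
    LinearMap.finrank_range_of_inj hL
  let b := stdOrthonormalBasis ℝ E
  let Q : LinearMap.range L.toLinearMap ≃ₗᵢ[ℝ] E :=
    ((stdOrthonormalBasis ℝ (LinearMap.range L.toLinearMap)).reindex (finCongr hfin)).repr.trans
      b.repr.symm
  let M : E →ₗ[ℝ] E := Q.toLinearEquiv.toLinearMap ∘ₗ L.toLinearMap.rangeRestrict
  let j : E →ₗᵢ[ℝ] F :=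
    (LinearMap.range L.toLinearMap).subtypeₗᵢ.comp Q.symm.toLinearIsometry
  have hjM : ∀ x, j (M x) = L x := fun x => by
    change ((Q.symm (Q (L.toLinearMap.rangeRestrict x)) : LinearMap.range L.toLinearMap) : F) = L x
    rw [Q.symm_apply_apply]
    rfl
  have hadj : (ContinuousLinearMap.adjoint L ∘L L).toLinearMap = LinearMap.adjoint M ∘ₗ M := by
    refine LinearMap.ext fun x => ext_inner_right ℝ fun y => ?_
    change inner ℝ (ContinuousLinearMap.adjoint L (L x)) y = inner ℝ (LinearMap.adjoint M (M x)) y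
    rw [ContinuousLinearMap.adjoint_inner_left, LinearMap.adjoint_inner_left, ← hjM, ← hjM,
      j.inner_map_map]
  have hdet : LinearMap.det (LinearMap.adjoint M) = LinearMap.det M := by
    rw [← LinearMap.det_toMatrix b.toBasis, ← LinearMap.det_toMatrix b.toBasis M,
      LinearMap.toMatrix_adjoint b b, Matrix.det_conjTranspose]
    simp
  refine ⟨j, M, hjM, ?_⟩
  rw [ContinuousLinearMap.det, hadj, LinearMap.det_comp, hdet, ← sq]

theorem euclideanHausdorffMeasure_image_linear {F : Type*} [NormedAddCommGroup F]
    [InnerProductSpace ℝ F] [FiniteDimensional ℝ F] [MeasurableSpace F] [BorelSpace F]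
    {L : Param d →L[ℝ] F} (hL : Function.Injective L) (s : Set (Param d)) :
    (μHE[d] : Measure F) (L '' s) = ENNReal.ofReal (volumeFactor L) * volume s := by
  obtain ⟨j, M, hjM, hdet⟩ := exists_linearIsometry_comp hL
  have himg : L '' s = j '' (M '' s) := by
    rw [image_image]
    exact image_congr fun x _ => (hjM x).symm
  rw [himg, j.isometry.euclideanHausdorffMeasure_image,
    EuclideanSpace.euclideanHausdorffMeasure_eq_volume, Measure.addHaar_image_linearMap,
    volumeFactor, hdet, Real.sqrt_sq_eq_abs]

/-- Densities: near `x` the map `f` is comparable, up to factors close to one, to its derivative. -/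
theorem tendsto_euclideanHausdorffMeasure_image_closedBall {F : Type*} [NormedAddCommGroup F]
    [InnerProductSpace ℝ F] [FiniteDimensional ℝ F] [MeasurableSpace F] [BorelSpace F]
    {f : Param d → F} {L : Param d →L[ℝ] F} {x : Param d} (hf : HasStrictFDerivAt f L x)
    (hL : Function.Injective L) :
    Tendsto (fun r => (μHE[d] : Measure F) (f '' closedBall x r) / volume (closedBall x r))
      (𝓝[>] 0) (𝓝 (ENNReal.ofReal (volumeFactor L))) := by
  obtain ⟨K, hK0, hK⟩ : ∃ K > 0, AntilipschitzWith K L :=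
    L.toLinearMap.exists_antilipschitzWith (LinearMap.ker_eq_bot.2 hL)
  have hKL : ∀ h, ‖h‖ ≤ K * ‖L h‖ := fun h => by
    simpa using hK.le_mul_dist h 0
  -- Both one-sided comparisons hold on all small balls, with any factor `c > 1`.
  have key : ∀ c : NNReal, 1 < c → ∀ᶠ r in 𝓝[>] (0 : ℝ),
      (μHE[d] : Measure F) (f '' closedBall x r) / volume (closedBall x r) ≤
          (c : ENNReal) ^ d * ENNReal.ofReal (volumeFactor L) ∧
        ENNReal.ofReal (volumeFactor L) ≤ (c : ENNReal) ^ d *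
          ((μHE[d] : Measure F) (f '' closedBall x r) / volume (closedBall x r)) := by
    intro c hc
    have hc' : (1 : ℝ) < c := hc
    have hKpos : (0 : ℝ) < K := hK0
    have hcpos : (0 : ℝ) < c := one_pos.trans hc'
    let ε : NNReal := ⟨(1 - 1 / c) / K, div_nonneg (sub_nonneg.2 ((div_le_one hcpos).2 hc'.le))
      hKpos.le⟩
    have hεK : (ε : ℝ) * K = 1 - 1 / c := div_mul_cancel₀ _ hKpos.ne'
    have hε : 0 < ε := by
      refine NNReal.coe_pos.1 (div_pos (sub_pos.2 ((div_lt_one hcpos).2 hc')) hKpos)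
    obtain ⟨s, hs, happ⟩ := hf.approximates_deriv_on_nhds (c := ε) (Or.inr hε)
    obtain ⟨δ, hδ, hδs⟩ := Metric.mem_nhds_iff.1 hs
    filter_upwards [Ioo_mem_nhdsGT hδ] with r hr
    have hball : closedBall x r ⊆ s := (closedBall_subset_ball hr.2).trans hδs
    have hvol0 : volume (closedBall x r) ≠ 0 := (measure_closedBall_pos _ _ hr.1).ne'
    have hvolt : volume (closedBall x r) ≠ ⊤ := measure_closedBall_lt_top.ne
    have herr : ∀ y ∈ closedBall x r, ∀ z ∈ closedBall x r,
        ‖f y - f z - (L y - L z)‖ ≤ (1 - 1 / c) * ‖L y - L z‖ := by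
      intro y hy z hz
      have h1 := happ y (hball hy) z (hball hz)
      rw [map_sub] at h1
      have h2 := hKL (y - z)
      rw [map_sub] at h2
      calc _ ≤ (ε : ℝ) * ‖y - z‖ := h1
        _ ≤ ε * (K * ‖L y - L z‖) := by gcongr
        _ = _ := by rw [← mul_assoc, hεK]
    have hup := euclideanHausdorffMeasure_image_le_of_dist_le (f := f) (g := L)
      (s := closedBall x r) (c := c) (fun y hy z hz => by
        rw [dist_eq_norm, dist_eq_norm]
        have h1 := norm_add_le (f y - f z - (L y - L z)) (L y - L z)
        rw [sub_add_cancel] at h1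
        have h2 := herr y hy z hz
        have h3 : 2 - 1 / (c : ℝ) ≤ c := by
          have : 0 ≤ (c - 1 : ℝ) ^ 2 / c := by positivity
          have h4 : (c - 1 : ℝ) ^ 2 / c = c - (2 - 1 / c) := by field_simp; ring
          linarith
        nlinarith [norm_nonneg (L y - L z)]) d
    have hlo := euclideanHausdorffMeasure_image_le_of_dist_le (f := L) (g := f)
      (s := closedBall x r) (c := c) (fun y hy z hz => by
        rw [dist_eq_norm, dist_eq_norm]
        have h1 := norm_sub_le (f y - f z) (f y - f z - (L y - L z))
        rw [sub_sub_cancel] at h1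
        have h2 := herr y hy z hz
        have h3 : ‖L y - L z‖ * (1 / c) ≤ ‖f y - f z‖ := by linarith
        rw [mul_one_div, div_le_iff₀ hcpos] at h3
        linarith) d
    rw [euclideanHausdorffMeasure_image_linear hL] at hup hlo
    constructor
    · rw [ENNReal.div_le_iff hvol0 hvolt, mul_assoc]
      exact hup
    · rw [← mul_div_assoc, ENNReal.le_div_iff_mul_le (Or.inl hvol0) (Or.inl hvolt)]
      exact hlo
  have hcont : ∀ a : ENNReal, a ≠ ⊤ →
      Tendsto (fun c : NNReal => (c : ENNReal) ^ d * a) (𝓝[>] 1) (𝓝 a) := by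
    intro a ha
    have h1 : Tendsto (fun c : NNReal => ((c ^ d : NNReal) : ENNReal) * a) (𝓝 1)
        (𝓝 (((1 ^ d : NNReal) : ENNReal) * a)) :=
      ENNReal.Tendsto.mul_const (ENNReal.tendsto_coe.2 ((continuous_pow d).tendsto 1))
        (Or.inr ha)
    simp only [one_pow, ENNReal.coe_one, one_mul, ENNReal.coe_pow] at h1
    exact h1.mono_left nhdsWithin_le_nhds
  rw [tendsto_order]
  constructor
  · intro a ha
    obtain ⟨c, hca, hc1⟩ := (((tendsto_order.1 (hcont a ha.ne_top)).2 _ ha).and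
      self_mem_nhdsWithin).exists
    filter_upwards [key c hc1] with r hr
    by_contra hcon
    exact absurd (hr.2.trans (by gcongr; exact not_lt.1 hcon)) (not_le.2 hca)
  · intro b hb
    obtain ⟨c, hcb, hc1⟩ := (((tendsto_order.1 (hcont _ ENNReal.ofReal_ne_top)).2 _ hb).and
      self_mem_nhdsWithin).exists
    filter_upwards [key c hc1] with r hr
    exact hr.1.trans_lt hcb

/-! ### Local parametrizations -/

/-- `ψ : W → S ∩ U` is a smooth parametrization of the part of `S` in the open set `U` by the open
set `W` of `ℝ^d`; its inverse is the restriction of a smooth map `κ` on `U`. -/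
structure LocalParam (S : Set (Ambient d)) (U : Set (Ambient d)) (W : Set (Param d))
    (ψ : Param d → Ambient d) (κ : Ambient d → Param d) : Prop where
  isOpen_U : IsOpen U
  isOpen_W : IsOpen W
  contDiffOn_ψ : ContDiffOn ℝ ∞ ψ W
  contDiffOn_κ : ContDiffOn ℝ ∞ κ U
  mapsTo_ψ : MapsTo ψ W (S ∩ U)
  mapsTo_κ : MapsTo κ (S ∩ U) W
  left_inv : ∀ x ∈ W, κ (ψ x) = x
  right_inv : ∀ p ∈ S ∩ U, ψ (κ p) = p

/-- The inclusion of `ℝ^d` into `ℝ^(d+1)` as the hyperplane where the last coordinate vanishes. -/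
def hyperplaneIncl (d : ℕ) : Param d →L[ℝ] Ambient d :=
  LinearMap.toContinuousLinearMap
    { toFun := fun x => WithLp.toLp 2 (Fin.snoc (α := fun _ => ℝ) (fun i => x i) 0)
      map_add' := fun x y => by
        ext i
        refine Fin.lastCases ?_ (fun i => ?_) i <;> simp
      map_smul' := fun c x => by
        ext i
        refine Fin.lastCases ?_ (fun i => ?_) i <;> simp }

/-- The map `ℝ^(d+1) → ℝ^d` which forgets the last coordinate. -/
def dropLast (d : ℕ) : Ambient d →L[ℝ] Param d :=
  LinearMap.toContinuousLinearMap
    { toFun := fun y => WithLp.toLp 2 (fun i => y i.castSucc)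
      map_add' := fun x y => by ext i; simp
      map_smul' := fun c x => by ext i; simp }

theorem hyperplaneIncl_last (x : Param d) : hyperplaneIncl d x (Fin.last d) = 0 := by
  simp [hyperplaneIncl]

theorem dropLast_hyperplaneIncl (x : Param d) : dropLast d (hyperplaneIncl d x) = x := by
  ext i
  simp [hyperplaneIncl, dropLast]

theorem hyperplaneIncl_dropLast {y : Ambient d} (hy : y (Fin.last d) = 0) :
    hyperplaneIncl d (dropLast d y) = y := by
  ext i
  refine Fin.lastCases ?_ (fun i => ?_) i <;> simp [hyperplaneIncl, dropLast, hy]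

/-- A straightening diffeomorphism, read in the first `d` coordinates, gives a local
parametrization. -/
theorem IsSmoothHypersurface.exists_localParam {S : Set (Ambient d)}
    (hS : IsSmoothHypersurface S) {p : Ambient d} (hp : p ∈ S) :
    ∃ U W ψ κ, p ∈ U ∧ LocalParam S U W ψ κ := by
  obtain ⟨Φ, hpΦ, hΦ, hΦsymm, hΦS⟩ := hS p hp
  have hlast : ∀ q ∈ S ∩ Φ.source, hyperplaneIncl d (dropLast d (Φ q)) = Φ q :=
    fun q hq => hyperplaneIncl_dropLast ((hΦS q hq.2).1 hq.1)
  refine ⟨Φ.source, hyperplaneIncl d ⁻¹' Φ.target, Φ.symm ∘ hyperplaneIncl d, dropLast d ∘ Φ,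
    hpΦ, Φ.open_source, Φ.open_target.preimage (hyperplaneIncl d).continuous,
    hΦsymm.comp (hyperplaneIncl d).contDiff.contDiffOn (mapsTo_preimage _ _),
    (dropLast d).contDiff.comp_contDiffOn hΦ, ?_, ?_, ?_, ?_⟩
  · intro x hx
    have h1 : Φ.symm (hyperplaneIncl d x) ∈ Φ.source := Φ.map_target hx
    refine ⟨(hΦS _ h1).2 ?_, h1⟩
    rw [Φ.right_inv hx, hyperplaneIncl_last]
  · intro q hq
    simpa [hlast q hq] using Φ.map_source hq.2
  · intro x hx
    simp [Φ.right_inv hx, dropLast_hyperplaneIncl]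
  · intro q hq
    simp [hlast q hq, Φ.left_inv hq.2]

namespace LocalParam

variable {S U : Set (Ambient d)} {W : Set (Param d)} {ψ : Param d → Ambient d}
  {κ : Ambient d → Param d}

theorem restrict (h : LocalParam S U W ψ κ) {W' : Set (Param d)} (hW' : IsOpen W')
    (hsub : W' ⊆ W) : LocalParam S (U ∩ κ ⁻¹' W') W' ψ κ where
  isOpen_U := h.contDiffOn_κ.continuousOn.isOpen_inter_preimage h.isOpen_U hW'
  isOpen_W := hW'
  contDiffOn_ψ := h.contDiffOn_ψ.mono hsub
  contDiffOn_κ := h.contDiffOn_κ.mono inter_subset_left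
  mapsTo_ψ := fun x hx => ⟨(h.mapsTo_ψ (hsub hx)).1, (h.mapsTo_ψ (hsub hx)).2, by
    rwa [mem_preimage, h.left_inv x (hsub hx)]⟩
  mapsTo_κ := fun _ hp => hp.2.2
  left_inv := fun x hx => h.left_inv x (hsub hx)
  right_inv := fun p hp => h.right_inv p ⟨hp.1, hp.2.1⟩

theorem contDiffAt_ψ (h : LocalParam S U W ψ κ) {x : Param d} (hx : x ∈ W) :
    ContDiffAt ℝ ∞ ψ x :=
  h.contDiffOn_ψ.contDiffAt (h.isOpen_W.mem_nhds hx)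

theorem contDiffAt_κ (h : LocalParam S U W ψ κ) {p : Ambient d} (hp : p ∈ U) :
    ContDiffAt ℝ ∞ κ p :=
  h.contDiffOn_κ.contDiffAt (h.isOpen_U.mem_nhds hp)

theorem hasFDerivAt_ψ (h : LocalParam S U W ψ κ) {x : Param d} (hx : x ∈ W) :
    HasFDerivAt ψ (fderiv ℝ ψ x) x :=
  ((h.contDiffAt_ψ hx).differentiableAt (by simp)).hasFDerivAt

theorem hasFDerivAt_κ (h : LocalParam S U W ψ κ) {p : Ambient d} (hp : p ∈ U) :
    HasFDerivAt κ (fderiv ℝ κ p) p :=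
  ((h.contDiffAt_κ hp).differentiableAt (by simp)).hasFDerivAt

theorem fderiv_injective (h : LocalParam S U W ψ κ) {x : Param d} (hx : x ∈ W) :
    Function.Injective (fderiv ℝ ψ x) := by
  have h1 := (h.hasFDerivAt_κ (h.mapsTo_ψ hx).2).comp x (h.hasFDerivAt_ψ hx)
  have h2 : HasFDerivAt (κ ∘ ψ) (ContinuousLinearMap.id ℝ (Param d)) x := by
    refine (hasFDerivAt_id x).congr_of_eventuallyEq ?_
    filter_upwards [h.isOpen_W.mem_nhds hx] with y hy using h.left_inv y hy
  have h3 := h1.unique h2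
  refine Function.LeftInverse.injective (g := fderiv ℝ κ (ψ x)) fun v => ?_
  exact DFunLike.congr_fun h3 v

theorem image_inter (h : LocalParam S U W ψ κ) (A : Set (Param d)) :
    ψ '' (A ∩ W) = κ ⁻¹' A ∩ (S ∩ U) := by
  ext p
  constructor
  · rintro ⟨x, hx, rfl⟩
    exact ⟨by rw [mem_preimage, h.left_inv x hx.2]; exact hx.1, h.mapsTo_ψ hx.2⟩
  · rintro ⟨hpA, hp⟩
    exact ⟨κ p, ⟨hpA, h.mapsTo_κ hp⟩, h.right_inv p hp⟩

theorem image_eq (h : LocalParam S U W ψ κ) : ψ '' W = S ∩ U := by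
  simpa using h.image_inter univ

theorem aemeasurable_κ (h : LocalParam S U W ψ κ) (hS : MeasurableSet S) (μ : Measure (Ambient d)) :
    AEMeasurable κ (μ.restrict (S ∩ U)) :=
  (h.contDiffOn_κ.continuousOn.mono inter_subset_right).aemeasurable
    (hS.inter h.isOpen_U.measurableSet)

theorem measure_inter_lt_top (h : LocalParam S U W ψ κ) {C : NNReal}
    (hlip : LipschitzOnWith C ψ W) (hvol : volume W < ⊤) :
    (μHE[d] : Measure (Ambient d)) (S ∩ U) < ⊤ := by
  have h1 := euclideanHausdorffMeasure_image_le_of_dist_le (f := ψ) (g := id) (s := W)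
    (fun y hy z hz => hlip.dist_le_mul y hy z hz) d
  rw [image_id, EuclideanSpace.euclideanHausdorffMeasure_eq_volume, h.image_eq] at h1
  exact h1.trans_lt (ENNReal.mul_lt_top (by finiteness) hvol)

/-- The **area formula** for a parametrization: in local coordinates, surface measure has the
density `√det (LᵀL)`, where `L` is the derivative of the parametrization. -/
theorem map_restrict (h : LocalParam S U W ψ κ) (hS : MeasurableSet S) {C : NNReal}
    (hlip : LipschitzOnWith C ψ W) (hvol : volume W < ⊤) :
    ((μHE[d] : Measure (Ambient d)).restrict (S ∩ U)).map κ =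
      (volume.restrict W).withDensity (fun x => ENNReal.ofReal (volumeFactor (fderiv ℝ ψ x))) := by
  set ν := ((μHE[d] : Measure (Ambient d)).restrict (S ∩ U)).map κ with hν
  have hν_apply : ∀ A, MeasurableSet A → ν A = (μHE[d] : Measure (Ambient d)) (ψ '' (A ∩ W)) := by
    intro A hA
    rw [hν, Measure.map_apply_of_aemeasurable (h.aemeasurable_κ hS _) hA,
      Measure.restrict_apply' (hS.inter h.isOpen_U.measurableSet), h.image_inter]
  have hνle : ∀ A, MeasurableSet A → ν A ≤ (C : ENNReal) ^ d * volume A := by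
    intro A hA
    have h1 := euclideanHausdorffMeasure_image_le_of_dist_le (f := ψ) (g := id) (s := A ∩ W)
      (fun y hy z hz => hlip.dist_le_mul y hy.2 z hz.2) d
    rw [image_id, EuclideanSpace.euclideanHausdorffMeasure_eq_volume] at h1
    rw [hν_apply A hA]
    refine h1.trans ?_
    gcongr
    exact inter_subset_left
  have hfin : IsFiniteMeasure ν := ⟨by
    rw [hν_apply univ MeasurableSet.univ, univ_inter, h.image_eq]
    exact h.measure_inter_lt_top hlip hvol⟩
  have hac : ν ≪ volume := Measure.AbsolutelyContinuous.mk fun A hA hA0 => by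
    simpa [hA0] using hνle A hA
  have hdens : ∀ᵐ x ∂(volume : Measure (Param d)), x ∈ W →
      ν.rnDeriv volume x = ENNReal.ofReal (volumeFactor (fderiv ℝ ψ x)) := by
    filter_upwards [Besicovitch.ae_tendsto_rnDeriv ν volume] with x hx hxW
    have h1 := tendsto_euclideanHausdorffMeasure_image_closedBall
      ((h.contDiffAt_ψ hxW).hasStrictFDerivAt (by simp)) (h.fderiv_injective hxW)
    refine tendsto_nhds_unique (hx.congr' ?_) h1
    obtain ⟨δ, hδ, hδW⟩ := Metric.isOpen_iff.1 h.isOpen_W x hxW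
    filter_upwards [Ioo_mem_nhdsGT hδ] with r hr
    rw [hν_apply _ measurableSet_closedBall,
      inter_eq_left.2 ((closedBall_subset_ball hr.2).trans hδW)]
  ext A hA
  have hAW : MeasurableSet (A ∩ W) := hA.inter h.isOpen_W.measurableSet
  calc ν A = ν (A ∩ W) := by
        rw [hν_apply A hA, hν_apply _ hAW, inter_assoc, inter_self]
    _ = ∫⁻ x in A ∩ W, ν.rnDeriv volume x := by
        rw [← withDensity_apply _ hAW, Measure.withDensity_rnDeriv_eq _ _ hac]
    _ = ∫⁻ x in A ∩ W, ENNReal.ofReal (volumeFactor (fderiv ℝ ψ x)) := by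
        refine setLIntegral_congr_fun_ae hAW ?_
        filter_upwards [hdens] with x hx hxA using hx hxA.2
    _ = _ := by
        rw [withDensity_apply _ hA, Measure.restrict_restrict hA]

end LocalParam

/-- Parametrizations by small balls; these are Lipschitz, and so have images of finite measure. -/
theorem IsSmoothHypersurface.exists_lipschitz_localParam {S : Set (Ambient d)}
    (hS : IsSmoothHypersurface S) {p : Ambient d} (hp : p ∈ S) :
    ∃ U W ψ κ, ∃ C : NNReal, p ∈ U ∧ LocalParam S U W ψ κ ∧ LipschitzOnWith C ψ W ∧
      volume W < ⊤ := by
  obtain ⟨U, W, ψ, κ, hpU, h⟩ := hS.exists_localParam hp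
  have hκp : κ p ∈ W := h.mapsTo_κ ⟨hp, hpU⟩
  obtain ⟨C, t, ht, hlip⟩ :=
    ((h.contDiffAt_ψ hκp).of_le (by exact_mod_cast le_top)).exists_lipschitzOnWith
  obtain ⟨δ, hδ, hsub⟩ := Metric.mem_nhds_iff.1 (inter_mem ht (h.isOpen_W.mem_nhds hκp))
  exact ⟨U ∩ κ ⁻¹' ball (κ p) δ, ball (κ p) δ, ψ, κ, C, ⟨hpU, mem_ball_self hδ⟩,
    h.restrict isOpen_ball (hsub.trans inter_subset_right),
    hlip.mono (hsub.trans inter_subset_left), measure_ball_lt_top⟩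

/-! ### Derivative of the volume factor -/

section LinearAlgebra

variable {E F : Type*} [NormedAddCommGroup E] [InnerProductSpace ℝ E]
  [NormedAddCommGroup F] [InnerProductSpace ℝ F]

/-- The trace of continuous linear endomorphisms. -/
abbrev trace (A : E →L[ℝ] E) : ℝ := LinearMap.trace ℝ E A.toLinearMap

theorem trace_eq_sum_inner {ι : Type*} [Fintype ι] (b : OrthonormalBasis ι ℝ E) (A : E →L[ℝ] E) :
    trace A = ∑ i, inner ℝ (b i) (A (b i)) :=
  LinearMap.trace_eq_sum_inner A.toLinearMap b

theorem trace_add (A B : E →L[ℝ] E) : trace (A + B) = trace A + trace B :=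
  map_add (LinearMap.trace ℝ E) A.toLinearMap B.toLinearMap

theorem trace_smul (c : ℝ) (A : E →L[ℝ] E) : trace (c • A) = c * trace A :=
  map_smul (LinearMap.trace ℝ E) c A.toLinearMap

variable [FiniteDimensional ℝ E] [FiniteDimensional ℝ F]

theorem trace_comp_comm (A : E →L[ℝ] F) (B : F →L[ℝ] E) : trace (B ∘L A) = trace (A ∘L B) :=
  LinearMap.trace_comp_comm' A.toLinearMap B.toLinearMap

theorem trace_smulRight (ℓ : E →L[ℝ] ℝ) (x : E) : trace (ℓ.smulRight x) = ℓ x :=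
  LinearMap.trace_smulRight ℓ.toLinearMap x

theorem trace_adjoint (A : E →L[ℝ] E) : trace (ContinuousLinearMap.adjoint A) = trace A := by
  rw [trace_eq_sum_inner (stdOrthonormalBasis ℝ E), trace_eq_sum_inner (stdOrthonormalBasis ℝ E)]
  simp only [ContinuousLinearMap.adjoint_inner_right]
  exact Finset.sum_congr rfl fun i _ => real_inner_comm _ _

theorem trace_comp_adjoint {D : E →L[ℝ] E} (hD : ContinuousLinearMap.adjoint D = D)
    (B : E →L[ℝ] E) : trace (D ∘L ContinuousLinearMap.adjoint B) = trace (D ∘L B) := by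
  rw [← trace_adjoint (D ∘L B), ContinuousLinearMap.adjoint_comp, hD, trace_comp_comm]

/-- The adjoint as a linear map; over `ℝ` it is linear rather than conjugate-linear. -/
def adjointL (E F : Type*) [NormedAddCommGroup E] [InnerProductSpace ℝ E] [FiniteDimensional ℝ E]
    [NormedAddCommGroup F] [InnerProductSpace ℝ F] [FiniteDimensional ℝ F] :
    (E →L[ℝ] F) →L[ℝ] (F →L[ℝ] E) :=
  LinearMap.toContinuousLinearMap
    { toFun := fun A => ContinuousLinearMap.adjoint A
      map_add' := fun A B => map_add _ A B
      map_smul' := fun c A => by simp }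

@[simp] theorem adjointL_apply (A : E →L[ℝ] F) :
    adjointL E F A = ContinuousLinearMap.adjoint A := rfl

theorem contDiff_gram {n : WithTop ℕ∞} :
    ContDiff ℝ n (fun L : E →L[ℝ] F => ContinuousLinearMap.adjoint L ∘L L) :=
  (adjointL E F).contDiff.clm_comp contDiff_id

theorem gram_injective {L : E →L[ℝ] F} (hL : Function.Injective L) :
    Function.Injective (ContinuousLinearMap.adjoint L ∘L L) := by
  rw [injective_iff_map_eq_zero]
  intro x hx
  have h1 : inner ℝ (L x) (L x) = 0 := by
    rw [← ContinuousLinearMap.adjoint_inner_left]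
    change inner ℝ ((ContinuousLinearMap.adjoint L ∘L L) x) x = 0
    rw [hx, inner_zero_left]
  exact hL ((inner_self_eq_zero.1 h1).trans (map_zero L).symm)

/-- For injective `L`, the Gram operator `LᵀL` is invertible. -/
theorem exists_gramEquiv {L : E →L[ℝ] F} (hL : Function.Injective L) :
    ∃ e : E ≃L[ℝ] E, (e : E →L[ℝ] E) = ContinuousLinearMap.adjoint L ∘L L :=
  ⟨(LinearEquiv.ofInjectiveEndo (ContinuousLinearMap.adjoint L ∘L L).toLinearMap
    (gram_injective hL)).toContinuousLinearEquiv, by ext; rfl⟩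

/-- The pseudoinverse `(LᵀL)⁻¹Lᵀ`. For injective `L`, it is the left inverse of `L` which vanishes
on the orthogonal complement of the range of `L`. -/
def pseudoInverse (L : E →L[ℝ] F) : F →L[ℝ] E :=
  (ContinuousLinearMap.adjoint L ∘L L).inverse ∘L ContinuousLinearMap.adjoint L

theorem pseudoInverse_comp {L : E →L[ℝ] F} (hL : Function.Injective L) :
    pseudoInverse L ∘L L = ContinuousLinearMap.id ℝ E := by
  obtain ⟨e, he⟩ := exists_gramEquiv hL
  rw [pseudoInverse, ContinuousLinearMap.comp_assoc, ← he, ContinuousLinearMap.inverse_equiv]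
  ext x
  simp

theorem pseudoInverse_apply_apply {L : E →L[ℝ] F} (hL : Function.Injective L) (x : E) :
    pseudoInverse L (L x) = x :=
  DFunLike.congr_fun (pseudoInverse_comp hL) x

theorem adjoint_inverse_gram {L : E →L[ℝ] F} (hL : Function.Injective L) :
    ContinuousLinearMap.adjoint (ContinuousLinearMap.adjoint L ∘L L).inverse =
      (ContinuousLinearMap.adjoint L ∘L L).inverse := by
  obtain ⟨e, he⟩ := exists_gramEquiv hL
  have hsymm : ∀ x y, inner ℝ (e x) y = inner ℝ x (e y) := fun x y => by
    have h : ∀ z, e z = ContinuousLinearMap.adjoint L (L z) := fun z => DFunLike.congr_fun he z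
    rw [h, h, ContinuousLinearMap.adjoint_inner_left, ContinuousLinearMap.adjoint_inner_right]
  rw [← he, ContinuousLinearMap.inverse_equiv]
  refine ((ContinuousLinearMap.eq_adjoint_iff _ _).2 fun x y => ?_).symm
  have := hsymm (e.symm x) (e.symm y)
  simpa using this.symm

theorem starProjection_range {L : E →L[ℝ] F} (hL : Function.Injective L) :
    (LinearMap.range L.toLinearMap).starProjection = L ∘L pseudoInverse L := by
  obtain ⟨e, he⟩ := exists_gramEquiv hL
  ext v
  refine Submodule.eq_starProjection_of_mem_of_inner_eq_zero ⟨pseudoInverse L v, rfl⟩ ?_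
  rintro _ ⟨y, rfl⟩
  change inner ℝ (v - L (pseudoInverse L v)) (L y) = 0
  have h1 : ContinuousLinearMap.adjoint L (L (pseudoInverse L v)) =
      ContinuousLinearMap.adjoint L v := by
    change (ContinuousLinearMap.adjoint L ∘L L) (pseudoInverse L v) = _
    rw [pseudoInverse, ← he, ContinuousLinearMap.inverse_equiv]
    simp
  rw [← ContinuousLinearMap.adjoint_inner_left, map_sub, h1, sub_self, inner_zero_left]

theorem contDiffAt_pseudoInverse {L : E →L[ℝ] F} (hL : Function.Injective L) {n : WithTop ℕ∞} :
    ContDiffAt ℝ n (pseudoInverse (E := E) (F := F)) L := by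
  obtain ⟨e, he⟩ := exists_gramEquiv hL
  have h1 : ContDiffAt ℝ n ContinuousLinearMap.inverse (ContinuousLinearMap.adjoint L ∘L L) := by
    rw [← he]
    exact contDiffAt_map_inverse e
  have h2 : ContDiffAt ℝ n
      (fun L : E →L[ℝ] F => (ContinuousLinearMap.adjoint L ∘L L).inverse) L :=
    ContDiffAt.comp (f := fun L : E →L[ℝ] F => ContinuousLinearMap.adjoint L ∘L L) L h1
      contDiff_gram.contDiffAt
  have h3 : ContDiffAt ℝ n (fun L : E →L[ℝ] F => adjointL E F L) L :=
    (adjointL E F).contDiff.contDiffAt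
  exact h2.clm_comp h3

theorem contDiff_det {n : WithTop ℕ∞} :
    ContDiff ℝ n (fun A : E →L[ℝ] E => A.det) := by
  let b := (stdOrthonormalBasis ℝ E).toBasis
  have h1 : (fun A : E →L[ℝ] E => A.det) = fun A =>
      ∑ σ : Equiv.Perm (Fin (Module.finrank ℝ E)), (Equiv.Perm.sign σ : ℤ) •
        ∏ i, (LinearMap.toMatrix b b A.toLinearMap) (σ i) i := by
    ext A
    rw [ContinuousLinearMap.det, ← LinearMap.det_toMatrix b, Matrix.det_apply]
    rfl
  rw [h1]
  refine ContDiff.sum fun σ _ => ContDiff.const_smul _ (contDiff_prod fun i _ => ?_)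
  simp only [LinearMap.toMatrix_apply]
  let ℓ : (E →L[ℝ] E) →L[ℝ] ℝ := LinearMap.toContinuousLinearMap
    { toFun := fun A => b.repr (A (b i)) (σ i)
      map_add' := fun A B => by simp
      map_smul' := fun c A => by simp }
  exact ℓ.contDiff

/-- **Jacobi's formula** for the derivative of the determinant at an invertible operator. -/
theorem fderiv_det_apply {A H : E →L[ℝ] E} (hAH : A ∘L H = ContinuousLinearMap.id ℝ _)
    (B : E →L[ℝ] E) :
    fderiv ℝ (fun A : E →L[ℝ] E => A.det) A B = A.det * trace (H ∘L B) := by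
  let b := (stdOrthonormalBasis ℝ E).toBasis
  have h1 : HasDerivAt (fun t : ℝ => (A + t • B).det)
      (fderiv ℝ (fun A : E →L[ℝ] E => A.det) A B) 0 := by
    have h2 : HasDerivAt (fun t : ℝ => A + t • B) B 0 := by
      simpa using ((hasDerivAt_id (0 : ℝ)).smul_const B).const_add A
    have h3 : HasFDerivAt (fun A : E →L[ℝ] E => A.det)
        (fderiv ℝ (fun A : E →L[ℝ] E => A.det) A) A :=
      ((contDiff_det (n := 1)).differentiable (by simp) A).hasFDerivAt
    exact h3.comp_hasDerivAt_of_eq 0 h2 (by simp)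
  refine h1.unique ?_
  set M := LinearMap.toMatrix b b (H ∘L B).toLinearMap with hM
  obtain ⟨P, hP⟩ : ∃ P : Polynomial ℝ, ∀ t : ℝ,
      (1 + t • M).det = 1 + M.trace * t + P.eval t * t ^ 2 :=
    ⟨_, fun t => Matrix.det_one_add_smul t M⟩
  have h4 : (fun t : ℝ => (A + t • B).det) =
      fun t => A.det * (1 + M.trace * t + P.eval t * t ^ 2) := by
    ext t
    rw [← hP]
    have h5 : A + t • B = A ∘L (ContinuousLinearMap.id ℝ E + t • (H ∘L B)) := by
      rw [ContinuousLinearMap.comp_add, ContinuousLinearMap.comp_smul,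
        ← ContinuousLinearMap.comp_assoc, hAH]
      rfl
    have h6 : (ContinuousLinearMap.id ℝ E + t • (H ∘L B)).det = (1 + t • M).det := by
      rw [ContinuousLinearMap.det, ← LinearMap.det_toMatrix b]
      congr 1
      change LinearMap.toMatrix b b (LinearMap.id + t • (H ∘L B).toLinearMap) = _
      rw [map_add, map_smul, LinearMap.toMatrix_id]
    rw [h5, ← h6]
    exact LinearMap.det_comp A.toLinearMap _
  have h7 : trace (H ∘L B) = M.trace := LinearMap.trace_eq_matrix_trace ℝ b _
  rw [h4, h7]
  have h8 := (((hasDerivAt_id (0 : ℝ)).const_mul M.trace).const_add 1).add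
    ((P.hasDerivAt 0).mul (hasDerivAt_pow 2 (0 : ℝ)))
  simpa using h8.const_mul A.det

theorem det_gram_pos {L : E →L[ℝ] F} (hL : Function.Injective L) :
    0 < (ContinuousLinearMap.adjoint L ∘L L).det := by
  obtain ⟨j, M, hjM, hdet⟩ := exists_linearIsometry_comp hL
  rw [hdet]
  have hM : Function.Injective M := fun x y hxy => hL (by rw [← hjM, ← hjM, hxy])
  have : LinearMap.det M ≠ 0 := (LinearEquiv.ofInjectiveEndo M hM).isUnit_det'.ne_zero
  positivity

theorem contDiffAt_volumeFactor {L : E →L[ℝ] F} (hL : Function.Injective L)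
    {n : WithTop ℕ∞} : ContDiffAt ℝ n (volumeFactor (E := E) (F := F)) L :=
  (contDiff_det.comp contDiff_gram).contDiffAt.sqrt (det_gram_pos hL).ne'

/-- Derivative of the volume factor: `d√det(LᵀL) = √det(LᵀL) tr(L⁺ dL)`, where `L⁺` is the
pseudoinverse. -/
theorem fderiv_volumeFactor_apply {L : E →L[ℝ] F} (hL : Function.Injective L)
    (B : E →L[ℝ] F) :
    fderiv ℝ (volumeFactor (E := E) (F := F)) L B =
      volumeFactor L * trace (pseudoInverse L ∘L B) := by
  have hpos := det_gram_pos hL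
  set G := ContinuousLinearMap.adjoint L ∘L L with hG
  have hgram : HasFDerivAt (fun L : E →L[ℝ] F => ContinuousLinearMap.adjoint L ∘L L) _ L :=
    (adjointL (E) F).hasFDerivAt.clm_comp (hasFDerivAt_id L)
  have hdet : HasFDerivAt (fun A : E →L[ℝ] E => A.det)
      (fderiv ℝ (fun A : E →L[ℝ] E => A.det) G) G :=
    ((contDiff_det (n := 1)).differentiable (by simp) G).hasFDerivAt
  have hcomp : HasFDerivAt
      (fun L : E →L[ℝ] F => (ContinuousLinearMap.adjoint L ∘L L).det) _ L :=
    HasFDerivAt.comp (g := fun A : E →L[ℝ] E => A.det) L hdet hgram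
  have h1 := (hcomp.sqrt hpos.ne').fderiv
  have hGinv : G ∘L G.inverse = ContinuousLinearMap.id ℝ _ := by
    obtain ⟨e, he⟩ := exists_gramEquiv hL
    rw [hG, ← he, ContinuousLinearMap.inverse_equiv]
    ext x
    simp
  have h2 : fderiv ℝ (volumeFactor (E := E) (F := F)) L B =
      1 / (2 * √G.det) * fderiv ℝ (fun A : E →L[ℝ] E => A.det) G
        (ContinuousLinearMap.adjoint L ∘L B + ContinuousLinearMap.adjoint B ∘L L) :=
    DFunLike.congr_fun h1 B
  have h3 : trace (G.inverse ∘L (ContinuousLinearMap.adjoint B ∘L L)) =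
      trace (G.inverse ∘L (ContinuousLinearMap.adjoint L ∘L B)) := by
    rw [← trace_adjoint (G.inverse ∘L (ContinuousLinearMap.adjoint B ∘L L)),
      ContinuousLinearMap.adjoint_comp, ContinuousLinearMap.adjoint_comp,
      ContinuousLinearMap.adjoint_adjoint, adjoint_inverse_gram hL, trace_comp_comm]
  rw [h2, fderiv_det_apply hGinv, ContinuousLinearMap.comp_add, trace_add, h3, volumeFactor,
    pseudoInverse, ← hG, ContinuousLinearMap.comp_assoc]
  have hs : √G.det ≠ 0 := (Real.sqrt_pos.2 hpos).ne'
  field_simp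
  rw [Real.sq_sqrt hpos.le]
  ring

end LinearAlgebra

/-! ### Derivatives along the hypersurface in local coordinates -/

namespace LocalParam

variable {S U : Set (Ambient d)} {W : Set (Param d)} {ψ : Param d → Ambient d}
  {κ : Ambient d → Param d}

theorem nhdsWithin_mem (h : LocalParam S U W ψ κ) {p : Ambient d} (hp : p ∈ U) :
    S ∩ U ∈ 𝓝[S] p :=
  inter_mem self_mem_nhdsWithin (mem_nhdsWithin_of_mem_nhds (h.isOpen_U.mem_nhds hp))

theorem tangentSpaceAt_eq (h : LocalParam S U W ψ κ) {x : Param d} (hx : x ∈ W) :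
    tangentSpaceAt S (ψ x) = LinearMap.range (fderiv ℝ ψ x).toLinearMap := by
  have hψx := h.mapsTo_ψ hx
  apply le_antisymm
  · refine Submodule.span_le.2 fun v hv => ?_
    -- On `S`, the identity coincides with `ψ ∘ κ` near `ψ x`, so both have the same derivative in
    -- tangent directions.
    have h1 : HasFDerivWithinAt (ψ ∘ κ) (fderiv ℝ ψ x ∘L fderiv ℝ κ (ψ x)) S (ψ x) := by
      refine (HasFDerivAt.comp (ψ x) ?_ (h.hasFDerivAt_κ hψx.2)).hasFDerivWithinAt
      rw [h.left_inv x hx]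
      exact h.hasFDerivAt_ψ hx
    have h2 : HasFDerivWithinAt id (fderiv ℝ ψ x ∘L fderiv ℝ κ (ψ x)) S (ψ x) := by
      refine h1.congr_of_eventuallyEq ?_ (h.right_inv _ hψx).symm
      filter_upwards [h.nhdsWithin_mem hψx.2] with q hq using (h.right_inv q hq).symm
    have h3 := (hasFDerivWithinAt_id (𝕜 := ℝ) (ψ x) S).unique_on h2 hv
    exact ⟨fderiv ℝ κ (ψ x) v, h3.symm⟩
  · rintro _ ⟨v, rfl⟩
    have h1 := (h.hasFDerivAt_ψ hx).hasFDerivWithinAt (s := W) |>.mapsTo_tangent_cone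
    rw [tangentConeAt_of_mem_nhds (h.isOpen_W.mem_nhds hx)] at h1
    refine Submodule.subset_span (tangentConeAt_mono ?_ (h1 (mem_univ v)))
    rw [h.image_eq]
    exact inter_subset_left

theorem proj_eq (h : LocalParam S U W ψ κ) {x : Param d} (hx : x ∈ W) :
    proj S (ψ x) = fderiv ℝ ψ x ∘L pseudoInverse (fderiv ℝ ψ x) := by
  rw [proj, ← starProjection_range (h.fderiv_injective hx)]
  have := h.tangentSpaceAt_eq hx
  congr!

variable {F : Type*} [NormedAddCommGroup F] [NormedSpace ℝ F]

theorem hasFDerivAt_comp (h : LocalParam S U W ψ κ) {x : Param d} (hx : x ∈ W)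
    {f : Ambient d → F} {f' : Ambient d →L[ℝ] F} (hf : HasFDerivWithinAt f f' S (ψ x)) :
    HasFDerivAt (f ∘ ψ) (f' ∘L fderiv ℝ ψ x) x :=
  (hf.comp x (h.hasFDerivAt_ψ hx).hasFDerivWithinAt
    (fun _ hy => (h.mapsTo_ψ hy).1)).hasFDerivAt (h.isOpen_W.mem_nhds hx)

theorem surfaceDeriv_eq (h : LocalParam S U W ψ κ) {x : Param d} (hx : x ∈ W)
    {f : Ambient d → F} (hf : DifferentiableWithinAt ℝ f S (ψ x)) :
    surfaceDeriv S f (ψ x) = fderiv ℝ (f ∘ ψ) x ∘L pseudoInverse (fderiv ℝ ψ x) := by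
  rw [(h.hasFDerivAt_comp hx hf.hasFDerivWithinAt).fderiv, surfaceDeriv, h.proj_eq hx,
    ContinuousLinearMap.comp_assoc]

theorem contDiffOn_comp (h : LocalParam S U W ψ κ) {f : Ambient d → F} {n : ℕ}
    (hf : ContDiffOn ℝ n f S) : ContDiffOn ℝ n (f ∘ ψ) W :=
  hf.comp (h.contDiffOn_ψ.of_le (by exact_mod_cast le_top)) fun _ hy => (h.mapsTo_ψ hy).1

theorem contDiffOn_fderiv (h : LocalParam S U W ψ κ) (n : ℕ) :
    ContDiffOn ℝ n (fderiv ℝ ψ) W :=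
  h.contDiffOn_ψ.fderiv_of_isOpen h.isOpen_W (by exact_mod_cast le_top)

theorem contDiffOn_pseudoInverse (h : LocalParam S U W ψ κ) (n : ℕ) :
    ContDiffOn ℝ n (fun x => pseudoInverse (fderiv ℝ ψ x)) W := fun x hx =>
  (contDiffAt_pseudoInverse (h.fderiv_injective hx)).comp_contDiffWithinAt x
    (h.contDiffOn_fderiv n x hx)

theorem contDiffOn_volumeFactor (h : LocalParam S U W ψ κ) (n : ℕ) :
    ContDiffOn ℝ n (fun x => volumeFactor (fderiv ℝ ψ x)) W := fun x hx =>
  (contDiffAt_volumeFactor (h.fderiv_injective hx)).comp_contDiffWithinAt x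
    (h.contDiffOn_fderiv n x hx)

/-- In local coordinates the surface divergence is the weighted divergence `g⁻¹ ∂_i (g wⁱ)`, where
`g` is the density of surface measure and the `wⁱ` are the components of the tangential field. -/
theorem volumeFactor_mul_surfaceDiv (h : LocalParam S U W ψ κ) {v : Ambient d → Ambient d}
    (hv : ContDiffOn ℝ 1 v S) (htan : ∀ p ∈ S, v p ∈ tangentSpaceAt S p) {x : Param d}
    (hx : x ∈ W) :
    volumeFactor (fderiv ℝ ψ x) * surfaceDiv S v (ψ x) =
      trace (fderiv ℝ (fun y => volumeFactor (fderiv ℝ ψ y) •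
        pseudoInverse (fderiv ℝ ψ y) (v (ψ y))) x) := by
  set w : Param d → Param d := fun y => pseudoInverse (fderiv ℝ ψ y) (v (ψ y)) with hw
  have hWx := h.isOpen_W.mem_nhds hx
  have hinj := h.fderiv_injective hx
  have hvw : ∀ y ∈ W, fderiv ℝ ψ y (w y) = v (ψ y) := by
    intro y hy
    have := htan (ψ y) (h.mapsTo_ψ hy).1
    rw [h.tangentSpaceAt_eq hy] at this
    obtain ⟨z, hz⟩ := this
    change fderiv ℝ ψ y z = _ at hz
    rw [hw]
    simp only
    rw [← hz, pseudoInverse_apply_apply (h.fderiv_injective hy)]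
  have hdL : HasFDerivAt (fderiv ℝ ψ) (fderiv ℝ (fderiv ℝ ψ) x) x :=
    (((h.contDiffOn_fderiv 1).contDiffAt hWx).differentiableAt (by simp)).hasFDerivAt
  have hdQ : DifferentiableAt ℝ (fun y => pseudoInverse (fderiv ℝ ψ y)) x :=
    ((h.contDiffOn_pseudoInverse 1).contDiffAt hWx).differentiableAt (by simp)
  have hdv : DifferentiableAt ℝ (v ∘ ψ) x :=
    ((h.contDiffOn_comp (n := 1) (by exact_mod_cast hv)).contDiffAt hWx).differentiableAt (by simp)
  have hdw : HasFDerivAt w (fderiv ℝ w x) x := (hdQ.clm_apply hdv).hasFDerivAt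
  have hdg : HasFDerivAt (fun y => volumeFactor (fderiv ℝ ψ y))
      (fderiv ℝ (volumeFactor (E := Param d) (F := Ambient d)) (fderiv ℝ ψ x) ∘L
        fderiv ℝ (fderiv ℝ ψ) x) x :=
    HasFDerivAt.comp x ((contDiffAt_volumeFactor (n := 1) hinj).differentiableAt
      (by simp)).hasFDerivAt hdL
  have hsymm : IsSymmSndFDerivAt ℝ ψ x :=
    (h.contDiffAt_ψ hx).isSymmSndFDerivAt (by
      rw [minSmoothness_of_isRCLikeNormedField]; exact WithTop.coe_le_coe.2 le_top)
  have hdv' : fderiv ℝ (v ∘ ψ) x =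
      fderiv ℝ (fderiv ℝ ψ) x (w x) + fderiv ℝ ψ x ∘L fderiv ℝ w x := by
    have h1 : HasFDerivAt (v ∘ ψ) _ x := (hdL.clm_apply hdw).congr_of_eventuallyEq (by
      filter_upwards [hWx] with y hy using (hvw y hy).symm)
    rw [h1.fderiv]
    ext1 k
    change fderiv ℝ ψ x (fderiv ℝ w x k) + fderiv ℝ (fderiv ℝ ψ) x k (w x) =
      fderiv ℝ (fderiv ℝ ψ) x (w x) k + fderiv ℝ ψ x (fderiv ℝ w x k)
    rw [hsymm.eq k (w x)]
    exact add_comm _ _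
  have hdgw : HasFDerivAt (fun y => volumeFactor (fderiv ℝ ψ y) • w y) _ x := hdg.smul hdw
  rw [hdgw.fderiv, surfaceDiv,
    h.surfaceDeriv_eq hx ((hv (ψ x) (h.mapsTo_ψ hx).1).differentiableWithinAt (by simp))]
  change _ * trace _ = _
  rw [← trace_comp_comm, hdv', ContinuousLinearMap.comp_add, ← ContinuousLinearMap.comp_assoc,
    pseudoInverse_comp hinj, ContinuousLinearMap.id_comp, trace_add, trace_add, trace_smul,
    trace_smulRight, ContinuousLinearMap.comp_apply, fderiv_volumeFactor_apply hinj]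
  ring

end LocalParam

/-- A function which coincides near each point of `S` with a `C^n` function of the local
coordinates is of class `C^n` on `S`. -/
theorem contDiffOn_of_localParam {S : Set (Ambient d)} (hS : IsSmoothHypersurface S) {F : Type*}
    [NormedAddCommGroup F] [NormedSpace ℝ F] {n : ℕ} {f : Ambient d → F}
    (hf : ∀ U W ψ κ, LocalParam S U W ψ κ → ContDiffOn ℝ n (f ∘ ψ) W) : ContDiffOn ℝ n f S := by
  intro p hp
  obtain ⟨U, W, ψ, κ, hpU, h⟩ := hS.exists_localParam hp
  have h1 : ContDiffOn ℝ n ((f ∘ ψ) ∘ κ) (S ∩ U) :=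
    (hf U W ψ κ h).comp ((h.contDiffOn_κ.of_le (by exact_mod_cast le_top)).mono inter_subset_right)
      h.mapsTo_κ
  have h2 : ContDiffOn ℝ n f (S ∩ U) := h1.congr fun q hq => by simp [h.right_inv q hq]
  exact (h2 p ⟨hp, hpU⟩).mono_of_mem_nhdsWithin (h.nhdsWithin_mem hpU)

theorem contDiffOn_surfaceDeriv {S : Set (Ambient d)} (hS : IsSmoothHypersurface S) {F : Type*}
    [NormedAddCommGroup F] [NormedSpace ℝ F] {n : ℕ} {f : Ambient d → F}
    (hf : ContDiffOn ℝ (n + 1) f S) : ContDiffOn ℝ n (surfaceDeriv S f) S := by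
  refine contDiffOn_of_localParam hS fun U W ψ κ h => ?_
  have h1 : ContDiffOn ℝ n (fun x => fderiv ℝ (f ∘ ψ) x ∘L pseudoInverse (fderiv ℝ ψ x)) W :=
    ((h.contDiffOn_comp (n := n + 1) (by exact_mod_cast hf)).fderiv_of_isOpen h.isOpen_W
      (by norm_cast)).clm_comp (h.contDiffOn_pseudoInverse n)
  refine h1.congr fun x hx => h.surfaceDeriv_eq hx ?_
  exact (hf _ (h.mapsTo_ψ hx).1).differentiableWithinAt (by simp)

theorem contDiffOn_proj {S : Set (Ambient d)} (hS : IsSmoothHypersurface S) (n : ℕ) :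
    ContDiffOn ℝ n (proj S) S :=
  contDiffOn_of_localParam hS fun _ _ _ _ h =>
    ((h.contDiffOn_fderiv n).clm_comp (h.contDiffOn_pseudoInverse n)).congr fun _ hx => h.proj_eq hx

/-! ### The divergence theorem -/

theorem integral_trace_fderiv_eq_zero {E : Type*} [NormedAddCommGroup E] [InnerProductSpace ℝ E]
    [FiniteDimensional ℝ E] [MeasurableSpace E] [BorelSpace E] {F : E → E} (hF : ContDiff ℝ 1 F)
    (hsupp : HasCompactSupport F) : ∫ x, trace (fderiv ℝ F x) = 0 := by
  let b := stdOrthonormalBasis ℝ E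
  have hdF := hF.differentiable (by simp)
  have hint : ∀ i, Integrable (fun x => inner ℝ (b i) (fderiv ℝ F x (b i))) := fun i => by
    refine Continuous.integrable_of_hasCompactSupport ?_ ?_
    · exact continuous_const.inner ((hF.continuous_fderiv (by simp)).clm_apply continuous_const)
    · exact (hsupp.fderiv ℝ).comp_left (g := fun A : E →L[ℝ] E => inner ℝ (b i) (A (b i)))
        (by simp)
  simp only [trace_eq_sum_inner b]
  rw [integral_finsetSum _ fun i _ => hint i]
  refine Finset.sum_eq_zero fun i _ => ?_
  have hfd : ∀ x, fderiv ℝ (fun y => inner ℝ (b i) (F y)) x (b i) =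
      inner ℝ (b i) (fderiv ℝ F x (b i)) := fun x => by
    have : HasFDerivAt (fun y => inner ℝ (b i) (F y)) (innerSL ℝ (b i) ∘L fderiv ℝ F x) x :=
      (innerSL ℝ (b i)).hasFDerivAt.comp x (hdF x).hasFDerivAt
    rw [this.fderiv]
    rfl
  -- Integration by parts against the constant function one.
  have key := integral_mul_fderiv_eq_neg_fderiv_mul_of_integrable (μ := (volume : Measure E))
    (f := fun _ => (1 : ℝ)) (g := fun y => inner ℝ (b i) (F y)) (v := b i)
    (by simp) (by simpa only [one_mul, hfd] using hint i) (by
      simp only [one_mul]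
      refine Continuous.integrable_of_hasCompactSupport (continuous_const.inner hF.continuous) ?_
      exact hsupp.comp_left (g := fun z => inner ℝ (b i) z) (by simp))
    (fun x _ => differentiableAt_const _)
    (fun x _ => (innerSL ℝ (b i)).differentiableAt.comp x (hdF x))
  simpa [hfd] using key

section Congr

variable {F : Type*} [NormedAddCommGroup F] [NormedSpace ℝ F] {S : Set (Ambient d)}

theorem surfaceDeriv_congr {f f₁ : Ambient d → F} {p : Ambient d} (h : f =ᶠ[𝓝[S] p] f₁)
    (hp : p ∈ S) : surfaceDeriv S f p = surfaceDeriv S f₁ p := by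
  rw [surfaceDeriv, surfaceDeriv, h.fderivWithin_eq (h.self_of_nhdsWithin hp)]

theorem surfaceDiv_congr {v v₁ : Ambient d → Ambient d} {p : Ambient d} (h : v =ᶠ[𝓝[S] p] v₁)
    (hp : p ∈ S) : surfaceDiv S v p = surfaceDiv S v₁ p := by
  rw [surfaceDiv, surfaceDiv, surfaceDeriv_congr h hp]

theorem surfaceDiv_zero (p : Ambient d) : surfaceDiv S (fun _ => 0) p = 0 := by
  have h := surfaceDeriv_eq (hasFDerivWithinAt_const (0 : Ambient d) p S)
  rw [surfaceDiv, h]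
  simp

theorem surfaceDiv_sum {ι : Type*} (s : Finset ι) {v : ι → Ambient d → Ambient d} {p : Ambient d}
    (h : ∀ i ∈ s, DifferentiableWithinAt ℝ (v i) S p) :
    surfaceDiv S (fun q => ∑ i ∈ s, v i q) p = ∑ i ∈ s, surfaceDiv S (v i) p := by
  have h1 := surfaceDeriv_eq (HasFDerivWithinAt.fun_sum fun i hi => (h i hi).hasFDerivWithinAt)
  simp only [surfaceDiv]
  rw [h1, ← map_sum]
  congr 1
  ext1 k
  simp [surfaceDeriv]

end Congr

theorem continuousOn_surfaceDiv {S : Set (Ambient d)} (hS : IsSmoothHypersurface S)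
    {v : Ambient d → Ambient d} (hv : ContDiffOn ℝ 1 v S) : ContinuousOn (surfaceDiv S v) S := by
  have h1 : ContinuousOn (surfaceDeriv S v) S :=
    (contDiffOn_surfaceDeriv hS (n := 0) (by simpa using hv)).continuousOn
  let ℓ : (Ambient d →L[ℝ] Ambient d) →L[ℝ] ℝ := LinearMap.toContinuousLinearMap
    { toFun := fun A => trace A
      map_add' := trace_add
      map_smul' := trace_smul }
  exact ℓ.continuous.comp_continuousOn h1

namespace LocalParam

variable {S U : Set (Ambient d)} {W : Set (Param d)} {ψ : Param d → Ambient d}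
  {κ : Ambient d → Param d}

theorem setIntegral_eq (h : LocalParam S U W ψ κ) (hS : MeasurableSet S) {C : NNReal}
    (hlip : LipschitzOnWith C ψ W) (hvol : volume W < ⊤) {f : Ambient d → ℝ}
    (hf : ContinuousOn f S) :
    ∫ p in S ∩ U, f p ∂(μHE[d] : Measure (Ambient d)) =
      ∫ x in W, volumeFactor (fderiv ℝ ψ x) * f (ψ x) := by
  have hSU := hS.inter h.isOpen_U.measurableSet
  have hW := h.isOpen_W.measurableSet
  have harea := h.map_restrict hS hlip hvol
  have hfψ : ContinuousOn (f ∘ ψ) W :=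
    hf.comp h.contDiffOn_ψ.continuousOn fun _ hx => (h.mapsTo_ψ hx).1
  have hg : AEMeasurable (fun x => ENNReal.ofReal (volumeFactor (fderiv ℝ ψ x)))
      (volume.restrict W) :=
    ((h.contDiffOn_volumeFactor 0).continuousOn.aemeasurable hW).ennreal_ofReal
  calc ∫ p in S ∩ U, f p ∂(μHE[d] : Measure (Ambient d))
      = ∫ p in S ∩ U, (f ∘ ψ) (κ p) ∂(μHE[d] : Measure (Ambient d)) :=
        setIntegral_congr_fun hSU fun p hp => by simp [h.right_inv p hp]
    _ = ∫ x, (f ∘ ψ) x ∂((μHE[d] : Measure (Ambient d)).restrict (S ∩ U)).map κ := by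
        refine (integral_map (h.aemeasurable_κ hS _) ?_).symm
        rw [harea]
        exact (hfψ.aestronglyMeasurable hW).mono_ac (withDensity_absolutelyContinuous _ _)
    _ = ∫ x in W, (ENNReal.ofReal (volumeFactor (fderiv ℝ ψ x))).toReal • (f ∘ ψ) x := by
        rw [harea]
        exact integral_withDensity_eq_integral_toReal_smul₀ hg
          (Eventually.of_forall fun _ => ENNReal.ofReal_lt_top) _
    _ = ∫ x in W, volumeFactor (fderiv ℝ ψ x) * f (ψ x) := by
        refine setIntegral_congr_fun hW fun x _ => ?_
        simp [ENNReal.toReal_ofReal (Real.sqrt_nonneg _), volumeFactor]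

/-- The divergence theorem for tangential fields supported in a coordinate patch. -/
theorem setIntegral_surfaceDiv_eq_zero (h : LocalParam S U W ψ κ) (hS : IsSmoothHypersurface S)
    (hSm : MeasurableSet S) {C : NNReal} (hlip : LipschitzOnWith C ψ W) (hvol : volume W < ⊤)
    {v : Ambient d → Ambient d} (hv : ContDiffOn ℝ 1 v S)
    (htan : ∀ p ∈ S, v p ∈ tangentSpaceAt S p) {K : Set (Ambient d)} (hK : IsCompact K)
    (hKS : K ⊆ S ∩ U) (hvK : ∀ p ∈ S, p ∉ K → v p = 0) :
    ∫ p in S, surfaceDiv S v p ∂(μHE[d] : Measure (Ambient d)) = 0 := by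
  set G : Param d → Param d := fun y => volumeFactor (fderiv ℝ ψ y) •
    pseudoInverse (fderiv ℝ ψ y) (v (ψ y)) with hG
  have hW := h.isOpen_W.measurableSet
  have hκK : IsCompact (κ '' K) :=
    hK.image_of_continuousOn (h.contDiffOn_κ.continuousOn.mono (hKS.trans inter_subset_right))
  have hκKW : κ '' K ⊆ W := (image_mono hKS).trans h.mapsTo_κ.image_subset
  have hzero : ∀ x ∉ κ '' K, W.indicator G x = 0 := by
    intro x hx
    by_cases hxW : x ∈ W
    · rw [indicator_of_mem hxW, hG]
      simp only
      rw [hvK _ (h.mapsTo_ψ hxW).1 fun hmem => hx ⟨ψ x, hmem, h.left_inv x hxW⟩, map_zero,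
        smul_zero]
    · exact indicator_of_notMem hxW _
  have hnhds : ∀ x ∉ W, W.indicator G =ᶠ[𝓝 x] fun _ => 0 := by
    intro x hx
    filter_upwards [hκK.isClosed.isOpen_compl.mem_nhds fun hmem => hx (hκKW hmem)] with y hy
      using hzero y hy
  have hGW : ∀ x ∈ W, W.indicator G =ᶠ[𝓝 x] G := by
    intro x hx
    filter_upwards [h.isOpen_W.mem_nhds hx] with y hy using indicator_of_mem hy _
  have hGdiff : ContDiffOn ℝ 1 G W := by
    refine (h.contDiffOn_volumeFactor 1).smul ((h.contDiffOn_pseudoInverse 1).clm_apply ?_)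
    exact h.contDiffOn_comp (n := 1) (by exact_mod_cast hv)
  have hdiff : ContDiff ℝ 1 (W.indicator G) := by
    refine contDiff_iff_contDiffAt.2 fun x => ?_
    by_cases hx : x ∈ W
    · exact (hGdiff.contDiffAt (h.isOpen_W.mem_nhds hx)).congr_of_eventuallyEq (hGW x hx)
    · exact contDiffAt_const.congr_of_eventuallyEq (hnhds x hx)
  calc ∫ p in S, surfaceDiv S v p ∂(μHE[d] : Measure (Ambient d))
      = ∫ p in S ∩ U, surfaceDiv S v p ∂(μHE[d] : Measure (Ambient d)) := by
        refine setIntegral_eq_of_subset_of_forall_sdiff_eq_zero hSm inter_subset_left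
          fun p hp => ?_
        have hpK : p ∉ K := fun hmem => hp.2 (hKS hmem)
        rw [← surfaceDiv_zero (S := S) p]
        refine surfaceDiv_congr ?_ hp.1
        filter_upwards [self_mem_nhdsWithin,
          mem_nhdsWithin_of_mem_nhds (hK.isClosed.isOpen_compl.mem_nhds hpK)] with q hq hqK
          using hvK q hq hqK
    _ = ∫ x in W, volumeFactor (fderiv ℝ ψ x) * surfaceDiv S v (ψ x) :=
        h.setIntegral_eq hSm hlip hvol (continuousOn_surfaceDiv hS hv)
    _ = ∫ x in W, trace (fderiv ℝ (W.indicator G) x) := by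
        refine setIntegral_congr_fun hW fun x hx => ?_
        rw [h.volumeFactor_mul_surfaceDiv hv htan hx, (hGW x hx).fderiv_eq]
    _ = ∫ x, trace (fderiv ℝ (W.indicator G) x) := by
        refine setIntegral_eq_integral_of_forall_compl_eq_zero fun x hx => ?_
        rw [(hnhds x hx).fderiv_eq, fderiv_fun_const]
        exact map_zero (LinearMap.trace ℝ (Param d))
    _ = 0 := integral_trace_fderiv_eq_zero hdiff (HasCompactSupport.intro hκK hzero)

end LocalParam

theorem isFiniteMeasure_surfaceMeasure {S : Set (Ambient d)} (hS : IsSmoothHypersurface S)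
    (hcompact : IsCompact S) : IsFiniteMeasure (surfaceMeasure S) := by
  refine isFiniteMeasure_restrict.2 (hcompact.measure_lt_top_of_nhdsWithin fun p hp => ?_).ne
  obtain ⟨U, W, ψ, κ, C, hpU, h, hlip, hvol⟩ := hS.exists_lipschitz_localParam hp
  exact ⟨S ∩ U, h.nhdsWithin_mem hpU, h.measure_inter_lt_top hlip hvol⟩

theorem integrable_surfaceMeasure {S : Set (Ambient d)} (hS : IsSmoothHypersurface S)
    (hcompact : IsCompact S) {f : Ambient d → ℝ} (hf : ContinuousOn f S) :
    Integrable f (surfaceMeasure S) := by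
  have := isFiniteMeasure_surfaceMeasure hS hcompact
  have h1 := hf.integrableOn_compact' (μ := surfaceMeasure S) hcompact
    hcompact.isClosed.measurableSet
  rwa [IntegrableOn, surfaceMeasure, Measure.restrict_restrict hcompact.isClosed.measurableSet,
    inter_self] at h1

/-- The **divergence theorem** on a closed hypersurface: the surface divergence of a tangential
`C¹` field has integral zero. -/
theorem integral_surfaceDiv_eq_zero {S : Set (Ambient d)} (hS : IsSmoothHypersurface S)
    (hcompact : IsCompact S) {v : Ambient d → Ambient d} (hv : ContDiffOn ℝ 1 v S)
    (htan : ∀ p ∈ S, v p ∈ tangentSpaceAt S p) :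
    ∫ p, surfaceDiv S v p ∂(surfaceMeasure S) = 0 := by
  have hSm := hcompact.isClosed.measurableSet
  choose U W ψ κ C hpU h hlip hvol using fun p : S => hS.exists_lipschitz_localParam p.2
  obtain ⟨t, ht⟩ := hcompact.elim_finite_subcover U (fun p => (h p).isOpen_U)
    fun p hp => mem_iUnion.2 ⟨⟨p, hp⟩, hpU ⟨p, hp⟩⟩
  obtain ⟨ρ, hρ⟩ := SmoothPartitionOfUnity.exists_isSubordinate (modelWithCornersSelf ℝ (Ambient d))
    hcompact.isClosed (fun i : t => U i) (fun i => (h i).isOpen_U)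
    (by simpa only [iUnion_coe_set, iUnion_subtype] using ht)
  have hρdiff : ∀ i, ContDiffOn ℝ 1 (ρ i) S := fun i =>
    ((ρ i).contMDiff.contDiff.of_le (by exact_mod_cast le_top)).contDiffOn
  have hvi : ∀ i, ContDiffOn ℝ 1 (fun q => ρ i q • v q) S := fun i => (hρdiff i).smul hv
  have hsum : ∀ p ∈ S, surfaceDiv S v p = ∑ i, surfaceDiv S (fun q => ρ i q • v q) p := by
    intro p hp
    rw [← surfaceDiv_sum _ fun i _ => (hvi i p hp).differentiableWithinAt (by simp)]
    refine surfaceDiv_congr ?_ hp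
    filter_upwards [self_mem_nhdsWithin] with q hq
    rw [← Finset.sum_smul, ← finsum_eq_sum_of_fintype, ρ.sum_eq_one hq, one_smul]
  have hcongr : ∫ p, surfaceDiv S v p ∂(surfaceMeasure S) =
      ∫ p, ∑ i, surfaceDiv S (fun q => ρ i q • v q) p ∂(surfaceMeasure S) :=
    setIntegral_congr_fun hSm hsum
  rw [hcongr, integral_finsetSum _ fun i _ =>
    integrable_surfaceMeasure hS hcompact (continuousOn_surfaceDiv hS (hvi i))]
  refine Finset.sum_eq_zero fun i _ => ?_
  refine (h i).setIntegral_surfaceDiv_eq_zero hS hSm (hlip i) (hvol i) (hvi i)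
    (fun p hp => Submodule.smul_mem _ _ (htan p hp))
    (hcompact.inter_right (isClosed_tsupport (ρ i))) (fun p hp => ⟨hp.1, hρ i hp.2⟩)
    fun p hp hpK => ?_
  rw [image_eq_zero_of_notMem_tsupport fun hmem => hpK ⟨hp, hmem⟩, zero_smul]

/-! ### Algebra of the stress tensor -/

section Pointwise

variable {S : Set (Ambient d)} {p : Ambient d}

theorem proj_comp_proj : proj S p ∘L proj S p = proj S p :=
  (tangentSpaceAt S p).isIdempotentElem_starProjection

theorem adjoint_proj : ContinuousLinearMap.adjoint (proj S p) = proj S p :=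
  ContinuousLinearMap.isSelfAdjoint_iff'.1 (isSelfAdjoint_starProjection _)

theorem surfaceDeriv_comp_proj {F : Type*} [NormedAddCommGroup F] [NormedSpace ℝ F]
    (f : Ambient d → F) : surfaceDeriv S f p ∘L proj S p = surfaceDeriv S f p := by
  rw [surfaceDeriv, ContinuousLinearMap.comp_assoc, proj_comp_proj]

theorem inner_proj_right {x : Ambient d} (hx : x ∈ tangentSpaceAt S p) (y : Ambient d) :
    inner ℝ x (proj S p y) = inner ℝ x y := by
  rw [← ContinuousLinearMap.adjoint_inner_left, adjoint_proj, proj,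
    Submodule.starProjection_eq_self_iff.2 hx]

theorem proj_mem (x : Ambient d) : proj S p x ∈ tangentSpaceAt S p :=
  Submodule.starProjection_apply_mem _ x

theorem normSqHS_eq_trace (A : Ambient d →L[ℝ] Ambient d) :
    normSqHS A = trace (ContinuousLinearMap.adjoint A ∘L A) := by
  rw [trace_eq_sum_inner (EuclideanSpace.basisFun (Fin (d + 1)) ℝ), normSqHS]
  refine Finset.sum_congr rfl fun k _ => ?_
  rw [ContinuousLinearMap.comp_apply, ContinuousLinearMap.adjoint_inner_right,
    real_inner_self_eq_norm_sq, EuclideanSpace.basisFun_apply]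

theorem advect_eq (v u : Ambient d → Ambient d) : advect S v u p = surfaceDeriv S u p (v p) := by
  rw [advect, surfaceGrad, ContinuousLinearMap.adjoint_adjoint]

theorem adjoint_rateOfStrain (u : Ambient d → Ambient d) :
    ContinuousLinearMap.adjoint (rateOfStrain S u p) = rateOfStrain S u p := by
  simp only [rateOfStrain, map_smulₛₗ, ContinuousLinearMap.adjoint_comp, adjoint_proj, map_add,
    ContinuousLinearMap.adjoint_adjoint, ContinuousLinearMap.comp_assoc, conj_trivial]
  exact congrArg (fun X => (1 / 2 : ℝ) • (proj S p ∘L X ∘L proj S p)) (add_comm _ _)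

theorem proj_comp_rateOfStrain (u : Ambient d → Ambient d) :
    proj S p ∘L rateOfStrain S u p = rateOfStrain S u p := by
  rw [rateOfStrain, ContinuousLinearMap.comp_smul, ← ContinuousLinearMap.comp_assoc,
    proj_comp_proj]

theorem rateOfStrain_comp_proj (u : Ambient d → Ambient d) :
    rateOfStrain S u p ∘L proj S p = rateOfStrain S u p := by
  rw [rateOfStrain, ContinuousLinearMap.smul_comp, ContinuousLinearMap.comp_assoc,
    ContinuousLinearMap.comp_assoc, proj_comp_proj]

/-- The symmetric tensor `D_S(u)` only sees the symmetric tangential part of the gradient, which is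
`D_S(u)` itself. -/
theorem trace_rateOfStrain_comp (u : Ambient d → Ambient d) :
    trace (rateOfStrain S u p ∘L surfaceDeriv S u p) = normSqHS (rateOfStrain S u p) := by
  set D := rateOfStrain S u p with hD
  set A := surfaceDeriv S u p
  set P := proj S p with hP
  have hDA : trace (D ∘L (P ∘L (A ∘L P))) = trace (D ∘L A) := by
    rw [← ContinuousLinearMap.comp_assoc, rateOfStrain_comp_proj, surfaceDeriv_comp_proj]
  have hDA' : trace (D ∘L (P ∘L (ContinuousLinearMap.adjoint A ∘L P))) = trace (D ∘L A) := by
    rw [← hDA, ← trace_comp_adjoint (adjoint_rateOfStrain u) (P ∘L (A ∘L P))]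
    simp only [ContinuousLinearMap.adjoint_comp, adjoint_proj, hP, hD,
      ContinuousLinearMap.comp_assoc]
  have hDeq : D = (1 / 2 : ℝ) • (P ∘L (ContinuousLinearMap.adjoint A ∘L P) + P ∘L (A ∘L P)) := by
    rw [hD, rateOfStrain, surfaceGrad, ContinuousLinearMap.adjoint_adjoint,
      ContinuousLinearMap.add_comp, ContinuousLinearMap.comp_add]
  have hDD : trace (D ∘L D) = trace (D ∘L A) := by
    have h1 : D ∘L D = (1 / 2 : ℝ) • (D ∘L (P ∘L (ContinuousLinearMap.adjoint A ∘L P)) +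
        D ∘L (P ∘L (A ∘L P))) := by
      rw [← ContinuousLinearMap.comp_add, ← ContinuousLinearMap.comp_smul, ← hDeq]
    rw [h1, trace_smul, trace_add, hDA, hDA']
    ring
  rw [normSqHS_eq_trace, adjoint_rateOfStrain, ← hD, hDD]

/-- The pressure does no work on a divergence-free field. -/
theorem trace_stress_comp (μs : ℝ) (u : Ambient d → Ambient d) (π : Ambient d → ℝ)
    (hdiv : surfaceDiv S u p = 0) :
    trace (stress S μs u π p ∘L surfaceDeriv S u p) =
      2 * μs * normSqHS (rateOfStrain S u p) := by
  have h1 : trace (proj S p ∘L surfaceDeriv S u p) = 0 := by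
    rw [trace_comp_comm, surfaceDeriv_comp_proj]
    exact hdiv
  have h2 : stress S μs u π p ∘L surfaceDeriv S u p =
      (2 * μs) • (rateOfStrain S u p ∘L surfaceDeriv S u p) +
        (-π p) • (proj S p ∘L surfaceDeriv S u p) := by
    ext1 x
    change (2 * μs) • rateOfStrain S u p (surfaceDeriv S u p x) -
      π p • proj S p (surfaceDeriv S u p x) = (2 * μs) • rateOfStrain S u p (surfaceDeriv S u p x) +
        (-π p) • proj S p (surfaceDeriv S u p x)
    rw [neg_smul, sub_eq_add_neg]
  rw [h2, trace_add, trace_smul, trace_smul, h1, trace_rateOfStrain_comp, mul_zero, add_zero]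

theorem stress_apply_mem (μs : ℝ) (u : Ambient d → Ambient d) (π : Ambient d → ℝ) (x : Ambient d) :
    stress S μs u π p x ∈ tangentSpaceAt S p := by
  have h1 : rateOfStrain S u p x = proj S p (rateOfStrain S u p x) :=
    (DFunLike.congr_fun (proj_comp_rateOfStrain u) x).symm
  refine Submodule.sub_mem _ (Submodule.smul_mem _ _ ?_) (Submodule.smul_mem _ _ (proj_mem x))
  rw [ContinuousLinearMap.coe_coe, h1]
  exact proj_mem _

/-! ### Product rules for the surface divergence -/

theorem surfaceDiv_smul {f : Ambient d → ℝ} {w : Ambient d → Ambient d}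
    (hf : DifferentiableWithinAt ℝ f S p) (hw : DifferentiableWithinAt ℝ w S p) :
    surfaceDiv S (fun q => f q • w q) p =
      surfaceDeriv S f p (w p) + f p * surfaceDiv S w p := by
  have h1 : HasFDerivWithinAt (fun q => f q • w q) _ S p :=
    hf.hasFDerivWithinAt.smul hw.hasFDerivWithinAt
  have h2 : surfaceDeriv S (fun q => f q • w q) p =
      f p • surfaceDeriv S w p + (surfaceDeriv S f p).smulRight (w p) := by
    rw [surfaceDeriv_eq h1]
    rfl
  rw [surfaceDiv, h2]
  change trace _ = _
  rw [trace_add, trace_smul, trace_smulRight, add_comm]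
  rfl

/-- The product rule `div_S (K w) = (w | div_S K) + tr (K ∂w)`, where `∂w` is the derivative of `w`
along `S`. It determines the transpose in the definition of `div_S K`. -/
theorem surfaceDiv_tensor_apply {K : Ambient d → Ambient d →L[ℝ] Ambient d}
    {w : Ambient d → Ambient d} (hK : DifferentiableWithinAt ℝ K S p)
    (hw : DifferentiableWithinAt ℝ w S p) :
    surfaceDiv S (fun q => K q (w q)) p =
      inner ℝ (w p) (surfaceDivTensor S K p) + trace (K p ∘L surfaceDeriv S w p) := by
  have h1 : HasFDerivWithinAt (fun q => K q (w q)) _ S p :=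
    hK.hasFDerivWithinAt.clm_apply hw.hasFDerivWithinAt
  have h2 : surfaceDeriv S (fun q => K q (w q)) p =
      K p ∘L surfaceDeriv S w p + (surfaceDeriv S K p).flip (w p) := by
    rw [SurfaceFlow.surfaceDeriv_eq h1]
    rfl
  rw [surfaceDiv, h2]
  change trace _ = _
  rw [trace_add, add_comm, trace_eq_sum_inner (EuclideanSpace.basisFun (Fin (d + 1)) ℝ),
    surfaceDivTensor, inner_sum]
  congr 1
  refine Finset.sum_congr rfl fun k _ => ?_
  rw [ContinuousLinearMap.adjoint_inner_right, EuclideanSpace.basisFun_apply, real_inner_comm]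
  rfl

/-- For a divergence-free field, convection of momentum is in divergence form after pairing with
the velocity. -/
theorem surfaceDiv_normSq_smul {u : Ambient d → Ambient d} (hu : DifferentiableWithinAt ℝ u S p)
    (hdiv : surfaceDiv S u p = 0) :
    surfaceDiv S (fun q => (1 / 2 * ‖u q‖ ^ 2 : ℝ) • u q) p = inner ℝ (u p) (advect S u u p) := by
  have h1 : HasFDerivWithinAt (fun q => 1 / 2 * ‖u q‖ ^ 2)
      ((innerSL ℝ (u p)) ∘L fderivWithin ℝ u S p) S p := by
    refine (hu.hasFDerivWithinAt.norm_sq.const_mul (1 / 2 : ℝ)).congr_fderiv ?_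
    ext k
    simp
  rw [surfaceDiv_smul h1.differentiableWithinAt hu, hdiv, mul_zero, add_zero, surfaceDeriv_eq h1,
    advect_eq]
  rfl

end Pointwise

theorem contDiffOn_rateOfStrain {S : Set (Ambient d)} (hS : IsSmoothHypersurface S)
    {u : Ambient d → Ambient d} (hu : ContDiffOn ℝ 2 u S) :
    ContDiffOn ℝ 1 (rateOfStrain S u) S := by
  have hA : ContDiffOn ℝ 1 (surfaceDeriv S u) S := by
    refine contDiffOn_surfaceDeriv hS (n := 1) ?_
    rwa [Nat.cast_one, one_add_one_eq_two]
  have hA' : ContDiffOn ℝ 1 (fun q => ContinuousLinearMap.adjoint (surfaceDeriv S u q)) S :=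
    (adjointL (Ambient d) (Ambient d)).contDiff.comp_contDiffOn hA
  have hP : ContDiffOn ℝ 1 (proj S) S := by exact_mod_cast contDiffOn_proj hS 1
  have h1 : ContDiffOn ℝ 1 (fun q => (1 / 2 : ℝ) • (proj S q ∘L
      (ContinuousLinearMap.adjoint (surfaceDeriv S u q) + surfaceDeriv S u q) ∘L proj S q)) S :=
    (hP.clm_comp ((hA'.add hA).clm_comp hP)).const_smul _
  refine h1.congr fun q _ => ?_
  rw [rateOfStrain, surfaceGrad, ContinuousLinearMap.adjoint_adjoint]

theorem contDiffOn_stress {S : Set (Ambient d)} (hS : IsSmoothHypersurface S) (μs : ℝ)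
    {u : Ambient d → Ambient d} {π : Ambient d → ℝ} (hu : ContDiffOn ℝ 2 u S)
    (hπ : ContDiffOn ℝ 1 π S) : ContDiffOn ℝ 1 (stress S μs u π) S :=
  ((contDiffOn_rateOfStrain hS hu).const_smul (2 * μs)).sub
    (hπ.smul (by exact_mod_cast contDiffOn_proj hS 1))

theorem continuous_normSqHS : Continuous (normSqHS (d := d)) := by
  unfold normSqHS
  fun_prop

/-! ### The energy balance -/

namespace IsClassicalSolution

variable {S : Set (Ambient d)} {μs T : ℝ} {u₀ : Ambient d → Ambient d}
  {u : ℝ → Ambient d → Ambient d} {π : ℝ → Ambient d → ℝ}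

theorem deriv_eq (hsol : IsClassicalSolution S μs T u₀ u π) {t : ℝ} (ht : t ∈ Ioo 0 T)
    {p : Ambient d} (hp : p ∈ S) :
    deriv (fun s => u s p) t =
      proj S p (surfaceDivTensor S (stress S μs (u t) (π t)) p - advect S (u t) (u t) p) := by
  have h := hsol.momentum t ht p hp
  rw [map_sub]
  rw [sub_eq_zero] at h
  exact eq_sub_of_add_eq h

/-- The velocity stays tangential: by the momentum equation, its normal component does not change
in time. -/
theorem mem_tangentSpaceAt (hsol : IsClassicalSolution S μs T u₀ u π)
    (hu₀ : ∀ p ∈ S, u₀ p ∈ tangentSpaceAt S p) {t : ℝ} (ht : t ∈ Ioo 0 T) {p : Ambient d}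
    (hp : p ∈ S) : u t p ∈ tangentSpaceAt S p := by
  rw [← Submodule.orthogonal_orthogonal (tangentSpaceAt S p)]
  refine (Submodule.mem_orthogonal _ _).2 fun z hz => ?_
  have hz' : ∀ y ∈ tangentSpaceAt S p, inner ℝ z y = 0 := fun y hy =>
    (Submodule.mem_orthogonal' _ _).1 hz y hy
  have hcont : ContinuousOn (fun s => inner ℝ z (u s p)) (Icc 0 t) := by
    refine continuousOn_const.inner ?_
    exact hsol.continuousOn.comp (f := fun s : ℝ => (s, p)) (by fun_prop)
      fun s hs => ⟨⟨hs.1, hs.2.trans_lt ht.2⟩, hp⟩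
  have hderiv : ∀ s ∈ Ioo 0 t, HasDerivAt (fun s => inner ℝ z (u s p)) 0 s := by
    intro s hs
    have hs' : s ∈ Ioo 0 T := ⟨hs.1, hs.2.trans ht.2⟩
    have h1 := (hasDerivAt_const s z).inner ℝ (hsol.differentiableAt_time s hs' p hp).hasDerivAt
    rwa [inner_zero_left, add_zero, hsol.deriv_eq hs' hp, hz' _ (proj_mem _)] at h1
  obtain ⟨c, -, hc⟩ := exists_hasDerivAt_eq_slope _ _ ht.1 hcont hderiv
  have h2 : inner ℝ z (u t p) - inner ℝ z (u 0 p) = 0 := by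
    rcases div_eq_zero_iff.1 hc.symm with h | h
    · exact h
    · linarith [ht.1]
  rw [hsol.initial p hp, hz' _ (hu₀ p hp), sub_zero] at h2
  exact h2

theorem hasDerivAt_kineticEnergy (hsol : IsClassicalSolution S μs T u₀ u π)
    (hS : IsSmoothHypersurface S) (hcompact : IsCompact S) {t : ℝ} (ht : t ∈ Ioo 0 T) :
    HasDerivAt (fun s => kineticEnergy S (u s))
      (∫ p, inner ℝ (u t p) (deriv (fun s => u s p) t) ∂(surfaceMeasure S)) t := by
  have := isFiniteMeasure_surfaceMeasure hS hcompact
  have hSm := hcompact.isClosed.measurableSet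
  obtain ⟨a, ha0, hat⟩ := exists_between ht.1
  obtain ⟨b, htb, hbT⟩ := exists_between ht.2
  have hsub : Icc a b ⊆ Ioo 0 T := fun s hs => ⟨ha0.trans_le hs.1, hs.2.trans_lt hbT⟩
  have hcont : ContinuousOn (fun z : ℝ × Ambient d =>
      (inner ℝ (u z.1 z.2) (deriv (fun s => u s z.2) z.1) : ℝ)) (Icc a b ×ˢ S) :=
    (hsol.continuousOn.mono (prod_mono (hsub.trans Ioo_subset_Ico_self) subset_rfl)).inner
      (hsol.continuousOn_deriv_time.mono (prod_mono hsub subset_rfl))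
  obtain ⟨C, hC⟩ := (isCompact_Icc.prod hcompact).exists_bound_of_continuousOn hcont
  have hcont_u : ∀ s ∈ Icc a b, ContinuousOn (fun p => 1 / 2 * ‖u s p‖ ^ 2) S := fun s hs =>
    continuousOn_const.mul ((hsol.contDiffOn_space s (hsub hs)).continuousOn.norm.pow 2)
  have hcont_t : ContinuousOn (fun p => (inner ℝ (u t p) (deriv (fun s => u s p) t) : ℝ)) S :=
    hcont.comp (f := fun p : Ambient d => (t, p)) (by fun_prop)
      fun p hp => ⟨⟨hat.le, htb.le⟩, hp⟩
  refine (hasDerivAt_integral_of_dominated_loc_of_deriv_le (Ioo_mem_nhds hat htb)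
    (F := fun s p => 1 / 2 * ‖u s p‖ ^ 2)
    (F' := fun s p => inner ℝ (u s p) (deriv (fun s => u s p) s)) (bound := fun _ => C)
    ?_ (integrable_surfaceMeasure hS hcompact (hcont_u t ⟨hat.le, htb.le⟩))
    (hcont_t.aestronglyMeasurable hSm) ?_ (integrable_const C) ?_).2
  · filter_upwards [Ioo_mem_nhds hat htb] with s hs
    exact (hcont_u s (Ioo_subset_Icc_self hs)).aestronglyMeasurable hSm
  · filter_upwards [ae_restrict_mem hSm] with p hp s hs
    exact hC (s, p) ⟨Ioo_subset_Icc_self hs, hp⟩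
  · filter_upwards [ae_restrict_mem hSm] with p hp s hs
    have h1 := (hsol.differentiableAt_time s (hsub (Ioo_subset_Icc_self hs)) p hp).hasDerivAt
    exact (h1.norm_sq.const_mul (1 / 2 : ℝ)).congr_deriv (by ring)

/-- Pairing the momentum equation with the velocity: up to surface divergences of tangential
fields, the power density is the dissipation. -/
theorem inner_deriv_eq (hsol : IsClassicalSolution S μs T u₀ u π) (hS : IsSmoothHypersurface S)
    (hu₀ : ∀ p ∈ S, u₀ p ∈ tangentSpaceAt S p) {t : ℝ} (ht : t ∈ Ioo 0 T) {p : Ambient d}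
    (hp : p ∈ S) :
    inner ℝ (u t p) (deriv (fun s => u s p) t) =
      surfaceDiv S (fun q => stress S μs (u t) (π t) q (u t q)) p
        - surfaceDiv S (fun q => (1 / 2 * ‖u t q‖ ^ 2 : ℝ) • u t q) p
        - 2 * μs * normSqHS (rateOfStrain S (u t) p) := by
  have hu := hsol.contDiffOn_space t ht
  have hdu : DifferentiableWithinAt ℝ (u t) S p := (hu p hp).differentiableWithinAt (by simp)
  have hdT : DifferentiableWithinAt ℝ (stress S μs (u t) (π t)) S p :=
    (contDiffOn_stress hS μs hu (hsol.contDiffOn_pressure t ht) p hp).differentiableWithinAt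
      (by simp)
  have hdiv := hsol.incompressible t ht p hp
  rw [hsol.deriv_eq ht hp, inner_proj_right (hsol.mem_tangentSpaceAt hu₀ ht hp), inner_sub_right,
    surfaceDiv_tensor_apply hdT hdu, surfaceDiv_normSq_smul hdu hdiv,
    trace_stress_comp μs (u t) (π t) hdiv]
  ring

end IsClassicalSolution

end SurfaceFlow

end

theorem proposition2p1 (d : ℕ) (S : Set (SurfaceFlow.Ambient d))
    (hS : SurfaceFlow.IsSmoothHypersurface S) (hcompact : IsCompact S) (hconn : IsConnected S)
    (μs T : ℝ) (u₀ : SurfaceFlow.Ambient d → SurfaceFlow.Ambient d)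
    (u : ℝ → SurfaceFlow.Ambient d → SurfaceFlow.Ambient d) (π : ℝ → SurfaceFlow.Ambient d → ℝ)
    (hu₀ : ∀ p ∈ S, u₀ p ∈ SurfaceFlow.tangentSpaceAt S p)
    (hsol : SurfaceFlow.IsClassicalSolution S μs T u₀ u π) :
    ∀ t ∈ Ioo 0 T,
      Integrable (fun p => ‖u t p‖ ^ 2) (SurfaceFlow.surfaceMeasure S) ∧
      Integrable (fun p => SurfaceFlow.normSqHS (SurfaceFlow.rateOfStrain S (u t) p))
        (SurfaceFlow.surfaceMeasure S) ∧
      HasDerivAt (fun s => SurfaceFlow.kineticEnergy S (u s))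
        (-2 * μs * ∫ p, SurfaceFlow.normSqHS (SurfaceFlow.rateOfStrain S (u t) p)
          ∂(SurfaceFlow.surfaceMeasure S)) t := by
  intro t ht
  have hu := hsol.contDiffOn_space t ht
  have hu1 : ContDiffOn ℝ 1 (u t) S := hu.of_le one_le_two
  have htan := fun p hp => hsol.mem_tangentSpaceAt hu₀ ht (p := p) hp
  have hT := SurfaceFlow.contDiffOn_stress hS μs hu (hsol.contDiffOn_pressure t ht)
  have hTu : ContDiffOn ℝ 1 (fun q => SurfaceFlow.stress S μs (u t) (π t) q (u t q)) S :=
    hT.clm_apply hu1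
  have huu : ContDiffOn ℝ 1 (fun q => (1 / 2 * ‖u t q‖ ^ 2 : ℝ) • u t q) S :=
    (contDiffOn_const.mul (hu1.norm_sq ℝ)).smul hu1
  have hint1 := SurfaceFlow.integrable_surfaceMeasure hS hcompact
    (SurfaceFlow.continuousOn_surfaceDiv hS hTu)
  have hint2 := SurfaceFlow.integrable_surfaceMeasure hS hcompact
    (SurfaceFlow.continuousOn_surfaceDiv hS huu)
  have hint3 : Integrable (fun p => SurfaceFlow.normSqHS (SurfaceFlow.rateOfStrain S (u t) p))
      (SurfaceFlow.surfaceMeasure S) :=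
    SurfaceFlow.integrable_surfaceMeasure hS hcompact
      (SurfaceFlow.continuous_normSqHS.comp_continuousOn
        (SurfaceFlow.contDiffOn_rateOfStrain hS hu).continuousOn)
  refine ⟨SurfaceFlow.integrable_surfaceMeasure hS hcompact (hu.continuousOn.norm.pow 2), hint3, ?_⟩
  refine (hsol.hasDerivAt_kineticEnergy hS hcompact ht).congr_deriv ?_
  have hcongr : ∫ p, inner ℝ (u t p) (deriv (fun s => u s p) t) ∂(SurfaceFlow.surfaceMeasure S) =
      ∫ p, (SurfaceFlow.surfaceDiv S
          (fun q => SurfaceFlow.stress S μs (u t) (π t) q (u t q)) p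
        - SurfaceFlow.surfaceDiv S (fun q => (1 / 2 * ‖u t q‖ ^ 2 : ℝ) • u t q) p
        - 2 * μs * SurfaceFlow.normSqHS (SurfaceFlow.rateOfStrain S (u t) p))
          ∂(SurfaceFlow.surfaceMeasure S) :=
    setIntegral_congr_fun hcompact.isClosed.measurableSet
      fun p hp => hsol.inner_deriv_eq hS hu₀ ht hp
  have hsub := integral_sub (hint1.sub hint2) (hint3.const_mul (2 * μs))
  simp only [Pi.sub_apply] at hsub
  rw [hcongr, hsub, integral_sub hint1 hint2,
    integral_const_mul,
    SurfaceFlow.integral_surfaceDiv_eq_zero hS hcompact hTu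
      (fun p _ => SurfaceFlow.stress_apply_mem μs (u t) (π t) (u t p)),
    SurfaceFlow.integral_surfaceDiv_eq_zero hS hcompact huu
      (fun p hp => Submodule.smul_mem _ _ (htan p hp))]
  ring
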